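/- Throughout, a graph is finite and simple. A graphon on an atomless standard probability space $(\Omega,\Sigma,\mu)$ is a symmetric measurable function $W:\Omega\times\Omega\to[0,1]$. It is $p$-regular if $\int_\Omega W(x,y)\,d\mu(y)=p$ for almost every $x$, and $p$-locally dense if $\iint_{U\times U}W\,d\mu\,d\mu\ge p\,\mu(U)^2$ for every measurable $U\subseteq\Omega$. For a graph $H$ with $e(H)$ edges, put $$t(H,W)=\int_{\Omega^{V(H)}}\prod_{uv\in E(H)}W(x_u,x_v)\prod_{v\in V(H)}d\mu(x_v).$$ For a nonempty graph $G$ on $n$ vertices, let $t(H,G)$ be the probability that a uniformly random map $V(H)\to V(G)$ is a graph homomorphism. Call $G$ $(p,\delta)$-locally dense if every $S\subseteq V(G)$ with $|S|\ge\delta n$ spans at least $p|S|^2/2$ edges, and $(p,\delta)$-nearly regular if all but at most $\delta n$ vertices have degree in $[(p-\delta)n,(p+\delta)n]$. The graph $H$ is regular-KNRS if for all $p,\varepsilon\in(0,1)$ there is $\delta>0$ such that $t(H,G)\ge p^{e(H)}-\varepsilon$ for every nonempty graph $G$ that is $(p,\delta)$-locally dense and $(p,\delta)$-nearly regular. **Proposition.**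 Let $H$ be a graph and suppose there is a constant $c>0$ such that $t(H,W)\ge c\,p^{e(H)}$ for every $p$ and every $p$-locally dense $p$-regular graphon $W$. Then $t(H,W)\ge p^{e(H)}$ for every $p$ and every $p$-locally dense $p$-regular graphon $W$, and $H$ is regular-KNRS. -/

import Mathlib

open MeasureTheory

universe u v

/-- A graphon on a measurable space `Ω`: a symmetric, jointly measurable function
`Ω × Ω → [0, 1]`. -/
structure Graphon (Ω : Type*) [MeasurableSpace Ω] where
  /-- the underlying function -/
  toFun : Ω → Ω → ℝ
  measurable' : Measurable (Function.uncurry toFun)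
  symm' : ∀ x y, toFun x y = toFun y x
  mem_Icc' : ∀ x y, toFun x y ∈ Set.Icc (0 : ℝ) 1

namespace Graphon

variable {Ω : Type*} [MeasurableSpace Ω]

/-- The degree function `d_W(x) = ∫ W(x, y) dμ(y)`. -/
noncomputable def deg (W : Graphon Ω) (μ : Measure Ω) (x : Ω) : ℝ :=
  ∫ y, W.toFun x y ∂μ

/-- `W` is `p`-regular if its degree function equals `p` almost everywhere. -/
def IsRegular (W : Graphon Ω) (μ : Measure Ω) (p : ℝ) : Prop :=
  ∀ᵐ x ∂μ, W.deg μ x = p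

/-- `W` is `p`-locally dense if `∬_{U × U} W ≥ p μ(U)²` for every measurable `U ⊆ Ω`. -/
def IsLocallyDense (W : Graphon Ω) (μ : Measure Ω) (p : ℝ) : Prop :=
  ∀ U : Set Ω, MeasurableSet U →
    p * μ.real U ^ 2 ≤ ∫ x in U, ∫ y in U, W.toFun x y ∂μ ∂μ

/-- The value `W(x_u, x_v)` at the (unordered) pair `e = uv`. -/
def onEdge {V : Type*} (W : Graphon Ω) (x : V → Ω) (e : Sym2 V) : ℝ :=
  Sym2.lift ⟨fun u v => W.toFun (x u) (x v), fun u v => W.symm' (x u) (x v)⟩ e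

/-- The homomorphism density
`t_μ(H, W) = ∫_{Ω^{V(H)}} ∏_{uv ∈ E(H)} W(x_u, x_v) ∏_{v ∈ V(H)} dμ(x_v)`. -/
noncomputable def homDensity {V : Type*} [Fintype V] (H : SimpleGraph V) [DecidableRel H.Adj]
    (W : Graphon Ω) (μ : Measure Ω) : ℝ :=
  ∫ x : V → Ω, ∏ e ∈ H.edgeFinset, W.onEdge x e ∂(Measure.pi fun _ => μ)

end Graphon

/-- `t(H, W) ≥ c p^{e(H)}` for every `p` and every `p`-locally dense, `p`-regular graphon `W` on
an atomless standard probability space. (`p` necessarily lies in `[0, 1]`, being the degree of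
a graphon; for a measure on a standard Borel space, being atomless means that
points have measure zero, which is `NullSingletonClass`.) -/
def HasRegularLocallyDenseBound {V : Type v} [Fintype V] (H : SimpleGraph V)
    [DecidableRel H.Adj] (c : ℝ) : Prop :=
  ∀ (Ω : Type u) [MeasurableSpace Ω] [StandardBorelSpace Ω]
    (μ : Measure Ω) [IsProbabilityMeasure μ] [NullSingletonClass μ] (W : Graphon Ω) (p : ℝ),
    W.IsLocallyDense μ p → W.IsRegular μ p →
      c * p ^ H.edgeFinset.card ≤ W.homDensity H μ

namespace SimpleGraph

/-- The homomorphism density `t(H, G)` of `H` in a finite graph `G`: the probability that a uniformly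
random map `V(H) → V(G)` is a graph homomorphism. -/
noncomputable def homDensity {V V' : Type*} (H : SimpleGraph V) (G : SimpleGraph V') : ℝ :=
  (Nat.card (H →g G) : ℝ) / (Nat.card V' : ℝ) ^ Nat.card V

/-- A finite graph `G` is `(p, δ)`-locally dense if every `S ⊆ V(G)` with `|S| ≥ δ |V(G)|`
spans at least `p |S|² / 2` edges. -/
def IsLocallyDense {V : Type*} (G : SimpleGraph V) (p δ : ℝ) : Prop :=
  ∀ S : Set V, δ * (Nat.card V : ℝ) ≤ (S.ncard : ℝ) →
    p * (S.ncard : ℝ) ^ 2 / 2 ≤ ((G.induce S).edgeSet.ncard : ℝ)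

/-- A finite graph `G` on `n` vertices is `(p, δ)`-nearly regular if all but at most `δ n` vertices
have degree in `[(p - δ) n, (p + δ) n]`. -/
def IsNearlyRegular {V : Type*} (G : SimpleGraph V) (p δ : ℝ) : Prop :=
  ({v : V | ((G.neighborSet v).ncard : ℝ) ∉
      Set.Icc ((p - δ) * (Nat.card V : ℝ)) ((p + δ) * (Nat.card V : ℝ))}.ncard : ℝ)
    ≤ δ * (Nat.card V : ℝ)

/-- `H` is regular-KNRS: for all `p, ε ∈ (0, 1)` there is `δ > 0` such that every (nonempty, finite)
graph `G` that is `(p, δ)`-locally dense and `(p, δ)`-nearly regular has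
`t(H, G) ≥ p^{e(H)} - ε`. -/
def IsRegularKNRS {V : Type*} [Fintype V] (H : SimpleGraph V) [DecidableRel H.Adj] : Prop :=
  ∀ p ∈ Set.Ioo (0 : ℝ) 1, ∀ ε ∈ Set.Ioo (0 : ℝ) 1, ∃ δ : ℝ, 0 < δ ∧
    ∀ (V' : Type) [Finite V'] [Nonempty V'] (G : SimpleGraph V'),
      G.IsLocallyDense p δ → G.IsNearlyRegular p δ →
        p ^ H.edgeFinset.card - ε ≤ H.homDensity G

end SimpleGraph

/-!
The first conclusion is a tensor power trick. If `W` is `p`-regular and `p`-locally dense, then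
`W ⊗ W` is `p²`-regular, and `t(H, W ⊗ W) = t(H, W)²`; once `W ⊗ W` is known to be `p²`-locally
dense, a bound with constant `c` yields one with constant `√c`
(`HasRegularLocallyDenseBound.sqrt`), and iterating gives the constant `1`.

That `W ⊗ W` is locally dense rests on the regularity of `W`. On an atomless space the inequality
`∬ f(x) W(x, y) f(y) ≥ p (∫ f)²` passes from indicators to functions with values in `[0, 1]`, by
approximating `W` with a step kernel and choosing a set with prescribed measure in each cell
(`Graphon.IsLocallyDense.le_sum_cellIntegral`). As `W - p` annihilates constants, shifting and
scaling extends it to all bounded `f`: the kernel `W - p` is positive semidefinite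
(`Graphon.IsLocallyDense.le_sum_cellIntegral_of_isRegular`). Now
`W ⊗ W - p² = (W - p) ⊗ W + p ⊗ (W - p)` is positive semidefinite, which on step functions is the positivity of Kronecker products
of matrices (`le_kronecker_quadraticForm`) and in general follows by approximating sets in the
product by unions of rectangles (`Graphon.IsLocallyDense.tensor`).

For the second conclusion, suppose that for some `p, ε` there are counterexamples with
`δ = 1 / (k + 1)` for every `k`. The weak regularity lemma (`exists_isCutRegular`) and the counting lemma
(`card_sq_mul_abs_sum_prod_sub_sum_prod_le`) replace each graph by a kernel on a weighted vertex
set of bounded size `K`, changing homomorphism densities by at most `ε / 2`. It is essential that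
the defects of regularity and of local density of these quotients are controlled by `δ` and not by
`ε`: for regularity this is averaging, and for local density it uses that the relevant quadratic
form is concave in each coordinate, so that its minimum over `[0, 1]`-valued functions is attained
at a set (`SimpleGraph.IsLocallyDense.le_sum_quotient`). Since `K` is fixed, a subsequence of the
quotients converges, and the limit is exactly regular and locally dense. Blown up to an atomless
space it is a graphon violating the first conclusion (`Graphon.le_weightedHomDensity`). Only
compactness of a finite-dimensional cube is needed, not that of the space of graphons.
-/

/-! ### Finite-valued maps, atomless spaces and tensor products -/

section FiniteValued

variable {X κ : Type*} [MeasurableSpace X] [Fintype κ] [MeasurableSpace κ]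
  [MeasurableSingletonClass κ]

theorem integrable_comp_mul {m : Measure X} {f : X → κ} (hf : Measurable f) {w : X → ℝ}
    (hw : Integrable w m) (G : κ → ℝ) : Integrable (fun z => G (f z) * w z) m := by
  obtain ⟨C, hC⟩ := (Set.finite_range fun k => ‖G k‖).bddAbove
  exact hw.bdd_mul (((measurable_of_finite G).comp hf).aestronglyMeasurable)
    (.of_forall fun z => hC ⟨f z, rfl⟩)

/-- Integrating a function of a finite-valued map against a weight reduces to a sum over the
fibres. -/
theorem integral_comp_mul_eq_sum {m : Measure X} {f : X → κ} (hf : Measurable f) {w : X → ℝ}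
    (hw : Integrable w m) (G : κ → ℝ) :
    ∫ z, G (f z) * w z ∂m = ∑ k, G k * ∫ z in f ⁻¹' {k}, w z ∂m := by
  have h : ∀ z, G (f z) * w z = ∑ k, G k * (f ⁻¹' {k}).indicator w z := by
    intro z
    rw [Finset.sum_eq_single (f z)]
    · rw [Set.indicator_of_mem (by simp)]
    · intro k _ hk
      rw [Set.indicator_of_notMem (by simpa using hk.symm), mul_zero]
    · simp
  simp_rw [h]
  rw [integral_finsetSum _ fun k _ =>
    ((hw.indicator (hf (measurableSet_singleton k))).const_mul _)]
  refine Finset.sum_congr rfl fun k _ => ?_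
  rw [integral_const_mul, integral_indicator (hf (measurableSet_singleton k))]

theorem integral_comp_eq_sum {m : Measure X} [IsFiniteMeasure m] {f : X → κ} (hf : Measurable f)
    (G : κ → ℝ) : ∫ z, G (f z) ∂m = ∑ k, G k * m.real (f ⁻¹' {k}) := by
  simpa using integral_comp_mul_eq_sum (m := m) hf (integrable_const (1 : ℝ)) G

end FiniteValued

section StandardBorel

variable {Ω : Type*} [MeasurableSpace Ω] [StandardBorelSpace Ω]

/-- In an atomless standard Borel space, a measurable set has measurable subsets of every smaller
measure: embed the space in `ℝ` and cut at a quantile, which exists because the distribution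
function is continuous. -/
theorem exists_measurableSet_subset_measureReal_eq (μ : Measure Ω) [IsFiniteMeasure μ]
    [NullSingletonClass μ] {C : Set Ω} (hC : MeasurableSet C) {s : ℝ} (hs : 0 ≤ s)
    (hsC : s ≤ μ.real C) : ∃ V ⊆ C, MeasurableSet V ∧ μ.real V = s := by
  have he := measurableEmbedding_embeddingReal Ω
  set e := embeddingReal Ω
  set ν : Measure ℝ := (μ.restrict C).map e with hν
  have : IsFiniteMeasure ν := by rw [hν]; infer_instance
  have hν_apply : ∀ t : Set ℝ, MeasurableSet t → ν.real t = μ.real (C ∩ e ⁻¹' t) := by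
    intro t ht
    rw [hν, map_measureReal_apply he.measurable ht, measureReal_restrict_apply (he.measurable ht),
      Set.inter_comm]
  have hatom : NullSingletonClass ν := by
    refine ⟨fun x => ?_⟩
    rw [hν, he.map_apply]
    refine Set.Subsingleton.measure_zero (fun a ha b hb => he.injective ?_) _
    rw [Set.mem_preimage, Set.mem_singleton_iff] at ha hb
    rw [ha, hb]
  -- the distribution function of the image of `μ` restricted to `C`
  set F : ℝ → ℝ := fun x => ν.real (Set.Iic x) with hF
  have htop : Filter.Tendsto F Filter.atTop (nhds (μ.real C)) := by
    have := tendsto_measure_Iic_atTop ν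
    have h2 := (ENNReal.tendsto_toReal (measure_ne_top ν Set.univ)).comp this
    have h3 : (ν Set.univ).toReal = μ.real C := by
      simpa [measureReal_def] using hν_apply _ MeasurableSet.univ
    rw [h3] at h2
    exact h2
  have hbot : Filter.Tendsto F Filter.atBot (nhds 0) := by
    have h1 : Filter.Tendsto (fun x => ν (Set.Iic x)) Filter.atBot (nhds 0) := by
      have := tendsto_measure_iInter_atBot (μ := ν) (s := fun x : ℝ => Set.Iic x)
        (fun x => measurableSet_Iic.nullMeasurableSet) (fun a b h => Set.Iic_subset_Iic.2 h)
        ⟨0, measure_ne_top _ _⟩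
      have h0 : (⋂ x : ℝ, Set.Iic x) = ∅ := by
        ext y
        simpa using ⟨y - 1, by linarith⟩
      rwa [h0, measure_empty] at this
    exact (ENNReal.tendsto_toReal ENNReal.zero_ne_top).comp h1
  have hcont : Continuous F := by
    have h1 : Continuous fun x : ℝ => ∫ _ in (0 : ℝ)..x, (1 : ℝ) ∂ν :=
      (integrable_const (1 : ℝ)).continuous_primitive 0
    have h2 : F = fun x => F 0 + ∫ _ in (0 : ℝ)..x, (1 : ℝ) ∂ν := by
      funext x
      rw [← intervalIntegral.integral_Iic_sub_Iic (integrable_const _).integrableOn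
        (integrable_const _).integrableOn]
      simp [hF]
    rw [h2]
    exact continuous_const.add h1
  by_cases h0 : s = 0
  · exact ⟨∅, Set.empty_subset _, MeasurableSet.empty, by simp [h0]⟩
  by_cases h1 : s = μ.real C
  · exact ⟨C, subset_rfl, hC, h1.symm⟩
  obtain ⟨a, ha⟩ := (hbot.eventually_lt_const (lt_of_le_of_ne hs (Ne.symm h0))).exists
  obtain ⟨b, hb⟩ := (htop.eventually_const_lt (lt_of_le_of_ne hsC h1)).exists
  obtain ⟨x, hx⟩ := mem_range_of_exists_le_of_exists_ge hcont ⟨a, ha.le⟩ ⟨b, hb.le⟩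
  exact ⟨C ∩ e ⁻¹' Set.Iic x, Set.inter_subset_left,
    hC.inter (he.measurable measurableSet_Iic), by rw [← hν_apply _ measurableSet_Iic]; exact hx⟩

end StandardBorel

namespace Graphon

variable {Ω Ω' : Type*} [MeasurableSpace Ω] [MeasurableSpace Ω']

theorem integrable_uncurry (W : Graphon Ω) (m : Measure (Ω × Ω)) [IsFiniteMeasure m] :
    Integrable (Function.uncurry W.toFun) m :=
  Integrable.of_mem_Icc 0 1 W.measurable'.aemeasurable (.of_forall fun z => W.mem_Icc' z.1 z.2)

/-- The tensor product `(W ⊗ W')((x, x'), (y, y')) = W(x, y) W'(x', y')`. -/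
def tensor (W : Graphon Ω) (W' : Graphon Ω') : Graphon (Ω × Ω') where
  toFun z w := W.toFun z.1 w.1 * W'.toFun z.2 w.2
  measurable' := by
    refine Measurable.mul (f := fun q : (Ω × Ω') × (Ω × Ω') => W.toFun q.1.1 q.2.1)
      (g := fun q : (Ω × Ω') × (Ω × Ω') => W'.toFun q.1.2 q.2.2) ?_ ?_
    · exact W.measurable'.comp (f := fun q : (Ω × Ω') × (Ω × Ω') => (q.1.1, q.2.1)) (by fun_prop)
    · exact W'.measurable'.comp (f := fun q : (Ω × Ω') × (Ω × Ω') => (q.1.2, q.2.2)) (by fun_prop)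
  symm' z w := by rw [W.symm', W'.symm']
  mem_Icc' z w := ⟨mul_nonneg (W.mem_Icc' _ _).1 (W'.mem_Icc' _ _).1,
    mul_le_one₀ (W.mem_Icc' _ _).2 (W'.mem_Icc' _ _).1 (W'.mem_Icc' _ _).2⟩

theorem onEdge_mem_Icc {V : Type*} (W : Graphon Ω) (x : V → Ω) (e : Sym2 V) :
    W.onEdge x e ∈ Set.Icc (0 : ℝ) 1 := by
  induction e with | _ u v => exact W.mem_Icc' _ _

theorem onEdge_tensor {V : Type*} (W : Graphon Ω) (W' : Graphon Ω') (x : V → Ω × Ω')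
    (e : Sym2 V) :
    (W.tensor W').onEdge x e = W.onEdge (fun v => (x v).1) e * W'.onEdge (fun v => (x v).2) e := by
  induction e with | _ u v => rfl

theorem homDensity_nonneg {V : Type*} [Fintype V] (H : SimpleGraph V) [DecidableRel H.Adj]
    (W : Graphon Ω) (μ : Measure Ω) : 0 ≤ W.homDensity H μ :=
  integral_nonneg fun x => Finset.prod_nonneg fun e _ => (W.onEdge_mem_Icc x e).1

theorem homDensity_tensor {V : Type*} [Fintype V] (H : SimpleGraph V) [DecidableRel H.Adj]
    (W : Graphon Ω) (W' : Graphon Ω') (μ : Measure Ω) (μ' : Measure Ω') [IsProbabilityMeasure μ]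
    [IsProbabilityMeasure μ'] :
    (W.tensor W').homDensity H (μ.prod μ') = W.homDensity H μ * W'.homDensity H μ' := by
  have h := measurePreserving_arrowProdEquivProdArrow Ω Ω' V (fun _ => μ) (fun _ => μ')
  unfold homDensity
  rw [← integral_prod_mul, ← h.integral_comp' (g := fun z : (V → Ω) × (V → Ω') =>
    (∏ e ∈ H.edgeFinset, W.onEdge z.1 e) * ∏ e ∈ H.edgeFinset, W'.onEdge z.2 e)]
  refine integral_congr_ae (.of_forall fun x => ?_)
  simp only [onEdge_tensor, Finset.prod_mul_distrib]
  rfl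

theorem IsRegular.tensor {W : Graphon Ω} {W' : Graphon Ω'} {μ : Measure Ω} {μ' : Measure Ω'}
    [IsProbabilityMeasure μ] [IsProbabilityMeasure μ'] {p p' : ℝ} (h : W.IsRegular μ p)
    (h' : W'.IsRegular μ' p') : (W.tensor W').IsRegular (μ.prod μ') (p * p') := by
  have h1 := Measure.quasiMeasurePreserving_fst (μ := μ) (ν := μ') |>.ae h
  have h2 := Measure.quasiMeasurePreserving_snd (μ := μ) (ν := μ') |>.ae h'
  filter_upwards [h1, h2] with z hz hz'
  rw [← hz, ← hz']
  exact integral_prod_mul (fun y => W.toFun z.1 y) (fun y => W'.toFun z.2 y)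

end Graphon

/-! ### Step approximations on product spaces -/

section StepApproximation

variable {Ω Ω' : Type*} [MeasurableSpace Ω] [MeasurableSpace Ω']

/-- The subsets of a product that depend on each coordinate only through a measurable map to a
finite type: the finite unions of measurable rectangles. -/
def gridSets (Ω Ω' : Type*) [MeasurableSpace Ω] [MeasurableSpace Ω'] : Set (Set (Ω × Ω')) :=
  {s | ∃ (n m : ℕ) (σ : Ω → Fin n) (τ : Ω' → Fin m) (T : Set (Fin n × Fin m)),
    Measurable σ ∧ Measurable τ ∧ s = Prod.map σ τ ⁻¹' T}

theorem mem_gridSets_of_finite {κ κ' : Type*} [Finite κ] [Finite κ'] [MeasurableSpace κ]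
    [MeasurableSpace κ'] [MeasurableSingletonClass κ] [MeasurableSingletonClass κ'] {σ : Ω → κ}
    {τ : Ω' → κ'} (hσ : Measurable σ) (hτ : Measurable τ) (T : Set (κ × κ')) :
    Prod.map σ τ ⁻¹' T ∈ gridSets Ω Ω' := by
  obtain ⟨n, ⟨e⟩⟩ := Finite.exists_equiv_fin κ
  obtain ⟨m, ⟨e'⟩⟩ := Finite.exists_equiv_fin κ'
  refine ⟨n, m, e ∘ σ, e' ∘ τ, Prod.map e.symm e'.symm ⁻¹' T, (measurable_of_finite e).comp hσ,
    (measurable_of_finite e').comp hτ, ?_⟩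
  ext z
  simp [Prod.map]

theorem isSetRing_gridSets : IsSetRing (gridSets Ω Ω') where
  empty_mem := ⟨1, 1, fun _ => 0, fun _ => 0, ∅, measurable_const, measurable_const, by simp⟩
  union_mem := by
    rintro _ _ ⟨n, m, σ, τ, T, hσ, hτ, rfl⟩ ⟨n', m', σ', τ', T', hσ', hτ', rfl⟩
    exact mem_gridSets_of_finite (hσ.prodMk hσ') (hτ.prodMk hτ')
      {q | (q.1.1, q.2.1) ∈ T ∨ (q.1.2, q.2.2) ∈ T'}
  sdiff_mem := by
    rintro _ _ ⟨n, m, σ, τ, T, hσ, hτ, rfl⟩ ⟨n', m', σ', τ', T', hσ', hτ', rfl⟩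
    exact mem_gridSets_of_finite (hσ.prodMk hσ') (hτ.prodMk hτ')
      {q | (q.1.1, q.2.1) ∈ T ∧ (q.1.2, q.2.2) ∉ T'}

theorem generateFrom_gridSets :
    (inferInstance : MeasurableSpace (Ω × Ω')) = MeasurableSpace.generateFrom (gridSets Ω Ω') := by
  classical
  apply le_antisymm
  · change Prod.instMeasurableSpace ≤ _
    rw [← generateFrom_prod]
    refine MeasurableSpace.generateFrom_mono ?_
    rintro _ ⟨A, hA, B, hB, rfl⟩
    have h := mem_gridSets_of_finite (σ := fun x : Ω => decide (x ∈ A))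
      (τ := fun y : Ω' => decide (y ∈ B)) (measurable_to_bool (by simpa [Set.preimage] using hA))
      (measurable_to_bool (by simpa [Set.preimage] using hB)) {(true, true)}
    convert h using 1
    ext z
    simp [Prod.map]
  · refine MeasurableSpace.generateFrom_le ?_
    rintro _ ⟨n, m, σ, τ, T, hσ, hτ, rfl⟩
    exact (hσ.prodMap hτ) T.toFinite.measurableSet

theorem exists_gridSets_measure_symmDiff_lt (m : Measure (Ω × Ω')) [IsFiniteMeasure m]
    {U : Set (Ω × Ω')} (hU : MeasurableSet U) {ε : ℝ} (hε : 0 < ε) :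
    ∃ t ∈ gridSets Ω Ω', m.real (symmDiff t U) < ε := by
  have huniv : (Set.univ : Set (Ω × Ω')) ∈ gridSets Ω Ω' :=
    ⟨1, 1, fun _ => 0, fun _ => 0, Set.univ, measurable_const, measurable_const, by simp⟩
  obtain ⟨t, ht, h⟩ := exists_measure_symmDiff_lt_of_generateFrom_isSetRing (μ := m)
    isSetRing_gridSets ⟨{Set.univ}, by simp, by simpa using huniv, by simp⟩
    generateFrom_gridSets hU (ENNReal.ofReal_pos.2 hε)
  exact ⟨t, ht, by
    rw [measureReal_def]
    exact (ENNReal.lt_ofReal_iff_toReal_lt (measure_ne_top _ _)).1 h⟩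

theorem measurableSet_of_mem_gridSets {t : Set (Ω × Ω')} (ht : t ∈ gridSets Ω Ω') :
    MeasurableSet t := by
  obtain ⟨n, m, σ, τ, T, hσ, hτ, rfl⟩ := ht
  exact (hσ.prodMap hτ) T.toFinite.measurableSet

theorem integral_abs_indicator_sub {X : Type*} [MeasurableSpace X] (m : Measure X)
    {s t : Set X} (hs : MeasurableSet s) (ht : MeasurableSet t) :
    ∫ z, |s.indicator (1 : X → ℝ) z - t.indicator (1 : X → ℝ) z| ∂m = m.real (symmDiff s t) := by
  rw [← integral_indicator_one (hs.symmDiff ht)]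
  refine integral_congr_ae (.of_forall fun z => ?_)
  by_cases h1 : z ∈ s <;> by_cases h2 : z ∈ t <;> simp [h1, h2, Set.mem_symmDiff]

/-- A `[0, 1]`-valued function on a product is approximated in `L¹` by functions depending on each
coordinate only through a finite-valued map. -/
theorem exists_step_approx (m : Measure (Ω × Ω')) [IsProbabilityMeasure m] {K : Ω × Ω' → ℝ}
    (hK : Measurable K) (hK01 : ∀ z, K z ∈ Set.Icc (0 : ℝ) 1) {ε : ℝ} (hε : 0 < ε) :
    ∃ (n n' : ℕ) (σ : Ω → Fin n) (τ : Ω' → Fin n') (F : Fin n → Fin n' → ℝ),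
      Measurable σ ∧ Measurable τ ∧ ∫ z, |K z - F (σ z.1) (τ z.2)| ∂m ≤ ε := by
  classical
  obtain ⟨N, hN⟩ := exists_nat_one_div_lt (half_pos hε)
  -- the level sets of `K` rounded down to a multiple of `1 / (N + 1)`
  set L : Ω × Ω' → ℕ := fun z => ⌊(N + 1 : ℝ) * K z⌋₊ with hL
  have hLm : Measurable L := Nat.measurable_floor.comp (hK.const_mul _)
  have hLlt : ∀ z, L z < N + 2 := fun z => by
    rw [hL, Nat.floor_lt (mul_nonneg (by positivity) (hK01 z).1)]
    push_cast
    nlinarith [(hK01 z).2]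
  set U : Fin (N + 2) → Set (Ω × Ω') := fun k => L ⁻¹' {(k : ℕ)} with hU
  have hUm : ∀ k, MeasurableSet (U k) := fun k => hLm (measurableSet_singleton _)
  have hη : 0 < ε / 2 / (2 * (N + 2)) := by positivity
  choose t ht htU using fun k => exists_gridSets_measure_symmDiff_lt m (hUm k) hη
  have htm := fun k => measurableSet_of_mem_gridSets (ht k)
  choose n n' σ τ T hσ hτ hT using ht
  let e := Fintype.equivFin ((k : Fin (N + 2)) → Fin (n k))
  let e' := Fintype.equivFin ((k : Fin (N + 2)) → Fin (n' k))
  refine ⟨_, _, fun x => e fun k => σ k x, fun y => e' fun k => τ k y,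
    fun a b => ∑ k : Fin (N + 2), (k : ℝ) / (N + 1) *
      (T k).indicator (1 : Fin (n k) × Fin (n' k) → ℝ) (e.symm a k, e'.symm b k),
    (measurable_of_finite e).comp (measurable_pi_lambda _ hσ),
    (measurable_of_finite e').comp (measurable_pi_lambda _ hτ), ?_⟩
  simp only [Equiv.symm_apply_apply]
  have hind : ∀ k z, (T k).indicator (1 : Fin (n k) × Fin (n' k) → ℝ) (σ k z.1, τ k z.2)
      = (t k).indicator (1 : Ω × Ω' → ℝ) z := by
    intro k z
    rw [hT k]
    rfl
  simp_rw [hind]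
  have hpt : ∀ z, |K z - ∑ k : Fin (N + 2), (k : ℝ) / (N + 1) *
        (t k).indicator (1 : Ω × Ω' → ℝ) z| ≤
      ε / 2 + ∑ k : Fin (N + 2), 2 *
        |(t k).indicator (1 : Ω × Ω' → ℝ) z - (U k).indicator (1 : Ω × Ω' → ℝ) z| := by
    intro z
    have h1 : ∑ k : Fin (N + 2), (k : ℝ) / (N + 1) * (U k).indicator (1 : Ω × Ω' → ℝ) z
        = L z / (N + 1) := by
      rw [Finset.sum_eq_single ⟨L z, hLlt z⟩]
      · simp [hU]
      · intro k _ hk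
        have : z ∉ U k := fun h => hk (Fin.ext (by simpa [hU] using h.symm))
        simp [this]
      · simp
    have h2 : |K z - L z / (N + 1)| ≤ ε / 2 := by
      have hp : (0 : ℝ) < N + 1 := by positivity
      have hlo := Nat.floor_le (mul_nonneg hp.le (hK01 z).1)
      have hhi := Nat.lt_floor_add_one ((N + 1 : ℝ) * K z)
      have heq : K z - L z / (N + 1) = ((N + 1) * K z - L z) / (N + 1) := by
        field_simp
      rw [heq, abs_of_nonneg (div_nonneg (by simp only [hL]; linarith) hp.le)]
      refine le_trans ?_ hN.le
      gcongr
      simp only [hL]; linarith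
    have h3 : |∑ k : Fin (N + 2), ((k : ℝ) / (N + 1) * (U k).indicator (1 : Ω × Ω' → ℝ) z -
        (k : ℝ) / (N + 1) * (t k).indicator (1 : Ω × Ω' → ℝ) z)| ≤
        ∑ k : Fin (N + 2), 2 *
        |(t k).indicator (1 : Ω × Ω' → ℝ) z - (U k).indicator (1 : Ω × Ω' → ℝ) z| := by
      refine (Finset.abs_sum_le_sum_abs _ _).trans (Finset.sum_le_sum fun k _ => ?_)
      rw [← mul_sub, abs_mul, abs_sub_comm]
      gcongr
      rw [abs_of_nonneg (by positivity), div_le_iff₀ (by positivity)]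
      have : ((k : ℕ) : ℝ) ≤ N + 1 := by exact_mod_cast Nat.lt_succ_iff.1 k.2
      linarith [(Nat.cast_nonneg N : (0 : ℝ) ≤ N)]
    rw [Finset.sum_sub_distrib, h1] at h3
    calc _ ≤ |K z - L z / (N + 1)| + |(L z : ℝ) / (N + 1) - ∑ k : Fin (N + 2),
          (k : ℝ) / (N + 1) * (t k).indicator (1 : Ω × Ω' → ℝ) z| := abs_sub_le _ _ _
      _ ≤ _ := add_le_add h2 h3
  have hint : ∀ k, Integrable (fun z => |(t k).indicator (1 : Ω × Ω' → ℝ) z -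
      (U k).indicator (1 : Ω × Ω' → ℝ) z|) m := fun k =>
    (((integrable_const (1 : ℝ)).indicator (htm k)).sub
      ((integrable_const (1 : ℝ)).indicator (hUm k))).abs
  refine (integral_mono_of_nonneg (.of_forall fun z => abs_nonneg _) ?_ (.of_forall hpt)).trans ?_
  · exact (integrable_const _).add (integrable_finsetSum _ fun k _ => (hint k).const_mul _)
  rw [integral_add (integrable_const _) (integrable_finsetSum _ fun k _ => (hint k).const_mul _),
    integral_finsetSum _ fun k _ => (hint k).const_mul _]
  simp_rw [integral_const_mul, integral_abs_indicator_sub m (htm _) (hUm _)]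
  have hsum : ∑ k : Fin (N + 2), 2 * m.real (symmDiff (t k) (U k)) ≤
      ∑ _k : Fin (N + 2), 2 * (ε / 2 / (2 * (N + 2))) := by
    gcongr with k
    exact (htU k).le
  have hc : ∑ _k : Fin (N + 2), 2 * (ε / 2 / (2 * (N + 2))) = ε / 2 := by
    rw [Finset.sum_const, Finset.card_univ, Fintype.card_fin, nsmul_eq_mul]
    push_cast
    field_simp
  rw [integral_const, probReal_univ, one_smul]
  linarith

end StepApproximation

/-! ### Positive semidefiniteness and local density of tensor products -/

section Quadratic

variable {κ κ' : Type*} [Fintype κ] [Fintype κ']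

theorem Matrix.posSemidef_sub_vecMulVec {X : Matrix κ κ ℝ} (hX : ∀ i j, X i j = X j i) {p : ℝ}
    {a : κ → ℝ} (h : ∀ c : κ → ℝ, p * (∑ i, c i * a i) ^ 2 ≤ ∑ i, ∑ j, c i * c j * X i j) :
    (X - p • Matrix.vecMulVec a a).PosSemidef := by
  rw [Matrix.posSemidef_iff_dotProduct_mulVec]
  refine ⟨?_, fun c => ?_⟩
  · ext i j
    simp [Matrix.vecMulVec_apply, hX i j, mul_comm (a i)]
  · have h1 := h c
    have h2 : ∑ i, ∑ j, c i * c j * (X i j - p * (a i * a j)) =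
        ∑ i, ∑ j, c i * c j * X i j - p * (∑ i, c i * a i) ^ 2 := by
      rw [sq, Finset.sum_mul_sum, Finset.mul_sum, ← Finset.sum_sub_distrib]
      refine Finset.sum_congr rfl fun i _ => ?_
      rw [Finset.mul_sum, ← Finset.sum_sub_distrib]
      exact Finset.sum_congr rfl fun j _ => by ring
    have h3 : star c ⬝ᵥ (X - p • Matrix.vecMulVec a a).mulVec c =
        ∑ i, ∑ j, c i * c j * (X i j - p * (a i * a j)) := by
      simp only [dotProduct, Matrix.mulVec, Finset.mul_sum]
      refine Finset.sum_congr rfl fun i _ => Finset.sum_congr rfl fun j _ => ?_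
      simp [Matrix.vecMulVec_apply]
      ring
    rw [h3, h2]
    linarith

/-- The lower bounds `X ≥ p aaᵀ` and `Y ≥ q bbᵀ` of quadratic forms tensorise, because
`X ⊗ Y - pq (a ⊗ b)(a ⊗ b)ᵀ` is the sum of `(X - p aaᵀ) ⊗ Y` and `p aaᵀ ⊗ (Y - q bbᵀ)`. -/
theorem le_kronecker_quadraticForm {X : Matrix κ κ ℝ} {Y : Matrix κ' κ' ℝ}
    (hX : ∀ i j, X i j = X j i) (hY : ∀ i j, Y i j = Y j i) {p q : ℝ} (hp : 0 ≤ p) (hq : 0 ≤ q)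
    {a : κ → ℝ} {b : κ' → ℝ}
    (h : ∀ c : κ → ℝ, p * (∑ i, c i * a i) ^ 2 ≤ ∑ i, ∑ j, c i * c j * X i j)
    (h' : ∀ c : κ' → ℝ, q * (∑ i, c i * b i) ^ 2 ≤ ∑ i, ∑ j, c i * c j * Y i j)
    (F : κ × κ' → ℝ) :
    p * q * (∑ k, F k * (a k.1 * b k.2)) ^ 2 ≤
      ∑ k, ∑ l, F k * F l * (X k.1 l.1 * Y k.2 l.2) := by
  have hX' := Matrix.posSemidef_sub_vecMulVec hX h
  have hY' := Matrix.posSemidef_sub_vecMulVec hY h'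
  have ha : (Matrix.vecMulVec a a).PosSemidef := by
    simpa using Matrix.posSemidef_vecMulVec_self_star a
  have hb : (Matrix.vecMulVec b b).PosSemidef := by
    simpa using Matrix.posSemidef_vecMulVec_self_star b
  have hYp : Y.PosSemidef := by
    have := hY'.add (hb.smul hq)
    simpa using this
  have hsum := (hX'.kronecker hYp).add ((ha.smul hp).kronecker hY')
  have := hsum.dotProduct_mulVec_nonneg F
  have h3 : ∑ k : κ × κ', ∑ l : κ × κ', F k * F l *
      (X k.1 l.1 * Y k.2 l.2 - p * q * (a k.1 * b k.2 * (a l.1 * b l.2))) =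
      ∑ k : κ × κ', ∑ l : κ × κ', F k * F l * (X k.1 l.1 * Y k.2 l.2) -
        p * q * (∑ k, F k * (a k.1 * b k.2)) ^ 2 := by
    rw [sq, Finset.sum_mul_sum, Finset.mul_sum, ← Finset.sum_sub_distrib]
    refine Finset.sum_congr rfl fun i _ => ?_
    rw [Finset.mul_sum, ← Finset.sum_sub_distrib]
    exact Finset.sum_congr rfl fun j _ => by ring
  have h4 : ∑ k : κ × κ', ∑ l : κ × κ', F k * F l *
      (X k.1 l.1 * Y k.2 l.2 - p * q * (a k.1 * b k.2 * (a l.1 * b l.2))) =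
      star F ⬝ᵥ (Matrix.kronecker (X - p • Matrix.vecMulVec a a) Y +
        Matrix.kronecker (p • Matrix.vecMulVec a a) (Y - q • Matrix.vecMulVec b b)).mulVec F := by
    simp only [dotProduct, Matrix.mulVec, Finset.mul_sum]
    refine Finset.sum_congr rfl fun i _ => Finset.sum_congr rfl fun j _ => ?_
    simp [Matrix.vecMulVec_apply, Matrix.kronecker]
    ring
  linarith [h4.trans_ge this]

end Quadratic

namespace Graphon

variable {Ω Ω' : Type*} [MeasurableSpace Ω] [MeasurableSpace Ω']

theorem setIntegral_setIntegral_eq (W : Graphon Ω) (μ : Measure Ω) [IsProbabilityMeasure μ]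
    (A B : Set Ω) : ∫ x in A, ∫ y in B, W.toFun x y ∂μ ∂μ =
      ∫ z in A ×ˢ B, Function.uncurry W.toFun z ∂(μ.prod μ) :=
  (setIntegral_prod _ (W.integrable_uncurry _).integrableOn).symm

theorem setIntegral_comm (W : Graphon Ω) (μ : Measure Ω) [IsProbabilityMeasure μ]
    (A B : Set Ω) : ∫ x in A, ∫ y in B, W.toFun x y ∂μ ∂μ =
      ∫ x in B, ∫ y in A, W.toFun x y ∂μ ∂μ := by
  rw [integral_integral_swap (W.integrable_uncurry _)]
  simp_rw [W.symm']

variable {κ : Type*} [Fintype κ] [MeasurableSpace κ] [MeasurableSingletonClass κ]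

/-- The integral of `W` over the product of two fibres of a finite-valued map. -/
noncomputable def cellIntegral (W : Graphon Ω) (μ : Measure Ω) (σ : Ω → κ) (i j : κ) : ℝ :=
  ∫ x in σ ⁻¹' {i}, ∫ y in σ ⁻¹' {j}, W.toFun x y ∂μ ∂μ

theorem integral_comp_mul_eq_sum_cellIntegral (W : Graphon Ω) (μ : Measure Ω)
    [IsProbabilityMeasure μ] {σ : Ω → κ} (hσ : Measurable σ) (G : κ → κ → ℝ) :
    ∫ z, G (σ z.1) (σ z.2) * Function.uncurry W.toFun z ∂(μ.prod μ) =
      ∑ i, ∑ j, G i j * W.cellIntegral μ σ i j := by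
  refine (integral_comp_mul_eq_sum (f := Prod.map σ σ) (hσ.prodMap hσ) (W.integrable_uncurry _)
    (fun k => G k.1 k.2)).trans ?_
  rw [Fintype.sum_prod_type]
  refine Finset.sum_congr rfl fun i _ => Finset.sum_congr rfl fun j _ => ?_
  rw [cellIntegral, setIntegral_setIntegral_eq, ← Set.singleton_prod_singleton,
    Set.preimage_prod_map_prod]

/-- In an atomless space, local density passes from sets to step functions with values in `[0, 1]`:
approximate `W` by a step kernel and replace the function by the indicator of a set having the same
mass on each step. -/
theorem IsLocallyDense.le_sum_cellIntegral [StandardBorelSpace Ω] {W : Graphon Ω} {μ : Measure Ω}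
    [IsProbabilityMeasure μ] [NullSingletonClass μ] {p : ℝ} (hW : W.IsLocallyDense μ p)
    {σ : Ω → κ} (hσ : Measurable σ) {d : κ → ℝ} (hd : ∀ i, d i ∈ Set.Icc (0 : ℝ) 1) :
    p * (∑ i, d i * μ.real (σ ⁻¹' {i})) ^ 2 ≤
      ∑ i, ∑ j, d i * d j * W.cellIntegral μ σ i j := by
  refine le_of_forall_pos_le_add fun ε hε => ?_
  obtain ⟨n, n', τ, τ', F, hτ, hτ', happ⟩ := exists_step_approx (μ.prod μ) W.measurable'
    (fun z => W.mem_Icc' z.1 z.2) (half_pos hε)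
  set ρ : Ω → κ × Fin n × Fin n' := fun x => (σ x, τ x, τ' x) with hρ
  have hρm : Measurable ρ := hσ.prodMk (hτ.prodMk hτ')
  have hcell : ∀ k, MeasurableSet (ρ ⁻¹' {k}) := fun k => hρm (measurableSet_singleton k)
  choose V hVs hVm hVμ using fun k => exists_measurableSet_subset_measureReal_eq μ (hcell k)
    (s := d k.1 * μ.real (ρ ⁻¹' {k})) (mul_nonneg (hd _).1 measureReal_nonneg)
    (mul_le_of_le_one_left measureReal_nonneg (hd _).2)
  set S : Set Ω := ⋃ k, V k with hS
  have hSm : MeasurableSet S := MeasurableSet.iUnion hVm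
  have hSk : ∀ k, (μ.restrict S).real (ρ ⁻¹' {k}) = d k.1 * μ.real (ρ ⁻¹' {k}) := by
    intro k
    rw [measureReal_restrict_apply (hcell k), ← hVμ]
    congr 1
    ext x
    simp only [hS, Set.mem_inter_iff, Set.mem_iUnion]
    constructor
    · rintro ⟨hx, l, hl⟩
      have h1 : ρ x = k := hx
      have h2 : ρ x = l := hVs l hl
      rwa [← h1, h2]
    · exact fun hx => ⟨hVs k hx, k, hx⟩
  have hSμ : μ.real S = ∑ i, d i * μ.real (σ ⁻¹' {i}) := by
    rw [← integral_comp_eq_sum hσ d]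
    have h1 := integral_comp_eq_sum (m := μ.restrict S) hρm (fun _ => (1 : ℝ))
    have h2 := integral_comp_eq_sum (m := μ) hρm (fun k => d k.1)
    simp only [hSk, one_mul] at h1
    rw [← h1] at h2
    simpa using h2.symm
  have hF : Integrable (fun z : Ω × Ω => F (τ z.1) (τ' z.2)) (μ.prod μ) := by
    simpa using integrable_comp_mul (m := μ.prod μ) (f := Prod.map τ τ') (hτ.prodMap hτ')
      (integrable_const (1 : ℝ)) (fun k => F k.1 k.2)
  have hWi := W.integrable_uncurry (μ.prod μ)
  have hD := (hWi.sub hF).abs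
  -- the step kernel does not distinguish the set `S` from the step function `d ∘ σ`
  have hstep : ∫ z in S ×ˢ S, F (τ z.1) (τ' z.2) ∂(μ.prod μ) =
      ∫ z, d (σ z.1) * d (σ z.2) * F (τ z.1) (τ' z.2) ∂(μ.prod μ) := by
    have hreal : ∀ (m : Measure Ω) [IsFiniteMeasure m] (k : (κ × Fin n × Fin n') × _),
        (m.prod m).real (Prod.map ρ ρ ⁻¹' {k}) = m.real (ρ ⁻¹' {k.1}) * m.real (ρ ⁻¹' {k.2}) := by
      intro m _ k
      rw [← measureReal_prod_prod, ← Set.preimage_prod_map_prod, Set.singleton_prod_singleton]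
    have h1 := integral_comp_eq_sum (m := (μ.restrict S).prod (μ.restrict S))
      (hρm.prodMap hρm) (fun k => F k.1.2.1 k.2.2.2)
    have h2 := integral_comp_eq_sum (m := μ.prod μ) (hρm.prodMap hρm)
      (fun k => d k.1.1 * d k.2.1 * F k.1.2.1 k.2.2.2)
    rw [← Measure.prod_restrict]
    refine h1.trans (Eq.trans ?_ h2.symm)
    refine Finset.sum_congr rfl fun k _ => ?_
    rw [hreal, hreal, hSk, hSk]
    ring
  have e1 : |∫ z in S ×ˢ S, Function.uncurry W.toFun z ∂(μ.prod μ) -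
      ∫ z in S ×ˢ S, F (τ z.1) (τ' z.2) ∂(μ.prod μ)| ≤ ε / 2 := by
    rw [← integral_sub hWi.integrableOn hF.integrableOn]
    refine abs_integral_le_integral_abs.trans (le_trans ?_ happ)
    exact setIntegral_le_integral hD (.of_forall fun z => abs_nonneg _)
  have e2 : |∫ z, d (σ z.1) * d (σ z.2) * Function.uncurry W.toFun z ∂(μ.prod μ) -
      ∫ z, d (σ z.1) * d (σ z.2) * F (τ z.1) (τ' z.2) ∂(μ.prod μ)| ≤ ε / 2 := by
    have hi : ∀ w : Ω × Ω → ℝ, Integrable w (μ.prod μ) →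
        Integrable (fun z => d (σ z.1) * d (σ z.2) * w z) (μ.prod μ) := fun w hw =>
      integrable_comp_mul (f := Prod.map σ σ) (hσ.prodMap hσ) hw (fun k => d k.1 * d k.2)
    rw [← integral_sub (hi _ hWi) (hi _ hF)]
    refine abs_integral_le_integral_abs.trans (le_trans ?_ happ)
    refine integral_mono_of_nonneg (.of_forall fun z => abs_nonneg _) hD (.of_forall fun z => ?_)
    change |d (σ z.1) * d (σ z.2) * _ - _| ≤ |_|
    rw [← mul_sub, abs_mul, abs_of_nonneg (mul_nonneg (hd _).1 (hd _).1)]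
    exact mul_le_of_le_one_left (abs_nonneg _) (mul_le_one₀ (hd _).2 (hd _).1 (hd _).2)
  have h0 := hW S hSm
  rw [setIntegral_setIntegral_eq, hSμ] at h0
  rw [integral_comp_mul_eq_sum_cellIntegral W μ hσ (fun i j => d i * d j)] at e2
  rw [hstep] at e1
  linarith [(abs_le.1 e1).2, (abs_le.1 e2).1]

theorem IsRegular.sum_cellIntegral {W : Graphon Ω} {μ : Measure Ω} [IsProbabilityMeasure μ]
    {p : ℝ} (hW : W.IsRegular μ p) {σ : Ω → κ} (hσ : Measurable σ) (c : κ → ℝ) :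
    ∑ i, ∑ j, c i * W.cellIntegral μ σ i j = p * ∑ i, c i * μ.real (σ ⁻¹' {i}) := by
  rw [← integral_comp_mul_eq_sum_cellIntegral W μ hσ (fun i _ => c i),
    ← integral_comp_eq_sum hσ c, integral_prod]
  · rw [← integral_const_mul]
    refine integral_congr_ae ?_
    filter_upwards [hW] with x hx
    simp only [Function.uncurry_apply_pair]
    rw [integral_const_mul]
    change c (σ x) * W.deg μ x = _
    rw [hx, mul_comm]
  · exact integrable_comp_mul (f := Prod.map σ σ) (hσ.prodMap hσ) (W.integrable_uncurry _)
      (fun k => c k.1)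

/-- For a regular graphon, local density self-improves to positive semidefiniteness of `W - p`:
since constants are in the kernel of `W - p`, a test function may be shifted and scaled to take
values in `[0, 1]`. -/
theorem IsLocallyDense.le_sum_cellIntegral_of_isRegular [StandardBorelSpace Ω] {W : Graphon Ω}
    {μ : Measure Ω} [IsProbabilityMeasure μ] [NullSingletonClass μ] {p : ℝ}
    (hW : W.IsLocallyDense μ p) (hreg : W.IsRegular μ p) {σ : Ω → κ} (hσ : Measurable σ)
    (c : κ → ℝ) :
    p * (∑ i, c i * μ.real (σ ⁻¹' {i})) ^ 2 ≤
      ∑ i, ∑ j, c i * c j * W.cellIntegral μ σ i j := by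
  set X := W.cellIntegral μ σ with hX
  set a : κ → ℝ := fun i => μ.real (σ ⁻¹' {i}) with ha
  have ha1 : ∑ i, a i = 1 := by
    simpa using (integral_comp_eq_sum (m := μ) hσ fun _ => (1 : ℝ)).symm
  -- `c` is shifted and scaled into `[0, 1]`
  obtain ⟨C, hC⟩ := (Set.finite_range fun i => |c i|).bddAbove
  set M : ℝ := max C 1 with hM
  have hM0 : 0 < M := lt_max_of_lt_right one_pos
  have hcM : ∀ i, |c i| ≤ M := fun i => (hC ⟨i, rfl⟩).trans (le_max_left _ _)
  have key := hW.le_sum_cellIntegral hσ (d := fun i => (c i + M) / (2 * M)) (fun i => by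
    have := abs_le.1 (hcM i)
    exact ⟨div_nonneg (by linarith) (by positivity), (div_le_one (by positivity)).2 (by linarith)⟩)
  have h1 : ∑ i, ∑ j, c i * X i j = p * ∑ i, c i * a i := hreg.sum_cellIntegral hσ c
  have h2 : ∑ i, ∑ j, c j * X i j = p * ∑ i, c i * a i := by
    rw [← h1, Finset.sum_comm]
    refine Finset.sum_congr rfl fun i _ => Finset.sum_congr rfl fun j _ => ?_
    rw [hX, cellIntegral, setIntegral_comm, cellIntegral]
  have h3 : ∑ i, ∑ j, X i j = p := by
    simpa [ha1, ← ha, ← hX] using hreg.sum_cellIntegral hσ fun _ => (1 : ℝ)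
  have e1 : ∑ i, (c i + M) / (2 * M) * a i = (∑ i, c i * a i + M) / (2 * M) := by
    have : ∑ i, (c i * a i + M * a i) = ∑ i, c i * a i + M := by
      rw [Finset.sum_add_distrib, ← Finset.mul_sum, ha1, mul_one]
    rw [← this, Finset.sum_div]
    exact Finset.sum_congr rfl fun i _ => by ring
  have e2 : ∑ i, ∑ j, (c i + M) / (2 * M) * ((c j + M) / (2 * M)) * X i j =
      (∑ i, ∑ j, c i * c j * X i j + M * (p * ∑ i, c i * a i) + M * (p * ∑ i, c i * a i) +
        M ^ 2 * p) / (2 * M) ^ 2 := by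
    rw [← h3]
    nth_rewrite 1 [h3]
    nth_rewrite 1 [h3]
    nth_rewrite 1 [← h1]
    rw [← h2]
    simp only [Finset.mul_sum, ← Finset.sum_add_distrib, Finset.sum_div]
    refine Finset.sum_congr rfl fun i _ => Finset.sum_congr rfl fun j _ => ?_
    field_simp
    ring
  change p * (∑ i, (c i + M) / (2 * M) * a i) ^ 2 ≤ _ at key
  rw [e1, e2, div_pow, mul_div_assoc', div_le_div_iff_of_pos_right (by positivity)] at key
  nlinarith [key]

theorem tensor_setIntegral_prod (W : Graphon Ω) (W' : Graphon Ω') (μ : Measure Ω)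
    (μ' : Measure Ω') [IsProbabilityMeasure μ] [IsProbabilityMeasure μ'] (A B : Set Ω)
    (A' B' : Set Ω') :
    ∫ z in A ×ˢ A', ∫ w in B ×ˢ B', (W.tensor W').toFun z w ∂(μ.prod μ') ∂(μ.prod μ') =
      (∫ x in A, ∫ y in B, W.toFun x y ∂μ ∂μ) * ∫ x in A', ∫ y in B', W'.toFun x y ∂μ' ∂μ' := by
  rw [← setIntegral_prod_mul]
  refine integral_congr_ae (.of_forall fun z => ?_)
  exact setIntegral_prod_mul (fun y => W.toFun z.1 y) (fun y => W'.toFun z.2 y) B B'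

/-- The tensor product of regular locally dense graphons is locally dense. Regularity is needed for
the factors to be bounded below as quadratic forms, not merely on nonnegative functions. -/
theorem IsLocallyDense.tensor [StandardBorelSpace Ω] [StandardBorelSpace Ω'] {W : Graphon Ω}
    {W' : Graphon Ω'} {μ : Measure Ω} {μ' : Measure Ω'} [IsProbabilityMeasure μ]
    [IsProbabilityMeasure μ'] [NullSingletonClass μ] [NullSingletonClass μ'] {p q : ℝ}
    (hp : 0 ≤ p) (hq : 0 ≤ q) (hW : W.IsLocallyDense μ p) (hreg : W.IsRegular μ p)
    (hW' : W'.IsLocallyDense μ' q) (hreg' : W'.IsRegular μ' q) :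
    (W.tensor W').IsLocallyDense (μ.prod μ') (p * q) := by
  intro U hU
  rw [setIntegral_setIntegral_eq]
  set P := μ.prod μ' with hP
  set T := W.tensor W' with hT
  have hTi := T.integrable_uncurry (P.prod P)
  -- on unions of rectangles the claim is a statement about Kronecker products
  have hgrid : ∀ t ∈ gridSets Ω Ω', p * q * P.real t ^ 2 ≤
      ∫ z in t ×ˢ t, Function.uncurry T.toFun z ∂(P.prod P) := by
    rintro t ⟨n, n', σ, τ, R, hσ, hτ, rfl⟩
    set F : Fin n × Fin n' → ℝ := R.indicator 1 with hF
    set f : Ω × Ω' → Fin n × Fin n' := Prod.map σ τ with hf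
    have hfm : Measurable f := hσ.prodMap hτ
    have hRm : MeasurableSet (f ⁻¹' R) := hfm R.toFinite.measurableSet
    have hcellm : ∀ k, f ⁻¹' {k} = (σ ⁻¹' {k.1}) ×ˢ (τ ⁻¹' {k.2}) := by
      intro k
      rw [hf, ← Set.preimage_prod_map_prod, Set.singleton_prod_singleton]
    have h1 : P.real (f ⁻¹' R) =
        ∑ k, F k * (μ.real (σ ⁻¹' {k.1}) * μ'.real (τ ⁻¹' {k.2})) := by
      have h := integral_comp_eq_sum (m := P) hfm F
      simp only [hcellm, hP, measureReal_prod_prod] at h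
      rw [← h, ← hP, ← integral_indicator_one hRm]
      rfl
    have h2 : ∫ z in (f ⁻¹' R) ×ˢ (f ⁻¹' R), Function.uncurry T.toFun z ∂(P.prod P) =
        ∑ k, ∑ l, F k * F l * (W.cellIntegral μ σ k.1 l.1 * W'.cellIntegral μ' τ k.2 l.2) := by
      have h := T.integral_comp_mul_eq_sum_cellIntegral P hfm (fun k l => F k * F l)
      have hc : ∀ k l, T.cellIntegral P f k l =
          W.cellIntegral μ σ k.1 l.1 * W'.cellIntegral μ' τ k.2 l.2 := by
        intro k l
        rw [cellIntegral, hcellm, hcellm]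
        exact tensor_setIntegral_prod W W' μ μ' _ _ _ _
      simp only [hc] at h
      rw [← h, ← integral_indicator (hRm.prod hRm)]
      refine integral_congr_ae (.of_forall fun z => ?_)
      by_cases hz1 : f z.1 ∈ R <;> by_cases hz2 : f z.2 ∈ R <;>
        simp [Set.indicator, hz1, hz2, hF]
    rw [h1, h2]
    refine le_kronecker_quadraticForm (fun i j => setIntegral_comm _ _ _ _)
      (fun i j => setIntegral_comm _ _ _ _) hp hq
      (fun c => hW.le_sum_cellIntegral_of_isRegular hreg hσ c)
      (fun c => hW'.le_sum_cellIntegral_of_isRegular hreg' hτ c) F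
  have hpq : 0 ≤ p * q := mul_nonneg hp hq
  refine le_of_forall_pos_le_add fun ε hε => ?_
  have hη : 0 < ε / (2 * (p * q) + 2) := by positivity
  obtain ⟨t, ht, htU⟩ := exists_gridSets_measure_symmDiff_lt P hU hη
  set η := P.real (symmDiff t U) with hηdef
  have htm := measurableSet_of_mem_gridSets ht
  have h0 := hgrid t ht
  -- both sides of the inequality for `U` differ by `O(η)` from those for `t`
  have h1 : P.real U ≤ P.real t + η := by
    refine (measureReal_mono ?_).trans (measureReal_union_le t (symmDiff t U))
    intro z hz
    by_cases h : z ∈ t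
    · exact Or.inl h
    · exact Or.inr (Or.inr ⟨hz, h⟩)
  have h2 : ∫ z in t ×ˢ t, Function.uncurry T.toFun z ∂(P.prod P) ≤
      ∫ z in U ×ˢ U, Function.uncurry T.toFun z ∂(P.prod P) + 2 * η := by
    set D := symmDiff t U with hD
    have hDm : MeasurableSet D := htm.symmDiff hU
    have hint : ∀ s, MeasurableSet s →
        Integrable (s.indicator (1 : (Ω × Ω') × (Ω × Ω') → ℝ)) (P.prod P) :=
      fun s hs => (integrable_const (1 : ℝ)).indicator hs
    have e1 : ∫ z, (D ×ˢ Set.univ).indicator (1 : (Ω × Ω') × (Ω × Ω') → ℝ) z ∂(P.prod P) = η := by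
      rw [integral_indicator_one (hDm.prod .univ), measureReal_prod_prod, probReal_univ, mul_one]
    have e2 : ∫ z, (Set.univ ×ˢ D).indicator (1 : (Ω × Ω') × (Ω × Ω') → ℝ) z ∂(P.prod P) = η := by
      rw [integral_indicator_one (MeasurableSet.univ.prod hDm), measureReal_prod_prod,
        probReal_univ, one_mul]
    rw [← integral_indicator (htm.prod htm), ← integral_indicator (hU.prod hU), two_mul]
    nth_rewrite 1 [← e1]
    rw [← e2]
    rw [← add_assoc, ← integral_add' (hTi.indicator (hU.prod hU)) (hint _ (hDm.prod .univ)),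
      ← integral_add' ((hTi.indicator (hU.prod hU)).add (hint _ (hDm.prod .univ)))
        (hint _ (MeasurableSet.univ.prod hDm))]
    refine integral_mono (hTi.indicator (htm.prod htm)) (((hTi.indicator (hU.prod hU)).add
      (hint _ (hDm.prod .univ))).add (hint _ (MeasurableSet.univ.prod hDm))) fun z => ?_
    have hT01 := T.mem_Icc' z.1 z.2
    by_cases a1 : z.1 ∈ t <;> by_cases a2 : z.2 ∈ t <;> by_cases b1 : z.1 ∈ U <;>
      by_cases b2 : z.2 ∈ U <;>
      simp [Set.indicator, a1, a2, b1, b2, hD, Set.mem_symmDiff, Function.uncurry] <;>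
      linarith [hT01.1, hT01.2]
  have h3 : P.real U ^ 2 ≤ P.real t ^ 2 + 2 * η := by
    have hη0 : 0 ≤ η := measureReal_nonneg
    nlinarith [measureReal_le_one (μ := P) (s := U), measureReal_le_one (μ := P) (s := t),
      measureReal_nonneg (μ := P) (s := U), measureReal_nonneg (μ := P) (s := t)]
  have h4 : η * (2 * (p * q) + 2) < ε := (lt_div_iff₀ (by positivity)).1 htU
  nlinarith [mul_le_mul_of_nonneg_left h3 hpq]

end Graphon

/-! ### Amplification of the constant -/

theorem Graphon.IsRegular.nonneg {Ω : Type*} [MeasurableSpace Ω] {W : Graphon Ω} {μ : Measure Ω}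
    [IsProbabilityMeasure μ] {p : ℝ} (h : W.IsRegular μ p) : 0 ≤ p := by
  obtain ⟨x, hx⟩ := h.exists
  rw [← hx]
  exact integral_nonneg fun y => (W.mem_Icc' x y).1

/-- Applying the bound to `W ⊗ W` improves the constant to its square root. -/
theorem HasRegularLocallyDenseBound.sqrt {V : Type v} [Fintype V] {H : SimpleGraph V}
    [DecidableRel H.Adj] {c : ℝ} (hc : 0 ≤ c) (h : HasRegularLocallyDenseBound.{u, v} H c) :
    HasRegularLocallyDenseBound.{u, v} H (√c) := by
  intro Ω _ _ μ _ _ W p hW hreg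
  have hp := hreg.nonneg
  have key := h (Ω × Ω) (μ.prod μ) (W.tensor W) (p * p) (hW.tensor hp hp hreg hW hreg)
    (hreg.tensor hreg)
  rw [Graphon.homDensity_tensor] at key
  refine le_of_sq_le_sq ?_ (W.homDensity_nonneg H μ)
  rw [mul_pow, Real.sq_sqrt hc]
  calc c * (p ^ H.edgeFinset.card) ^ 2 = c * (p * p) ^ H.edgeFinset.card := by ring
    _ ≤ _ := key
    _ = _ := by ring

/-- Iterating the square root drives any positive constant to `1`. -/
theorem HasRegularLocallyDenseBound.one {V : Type v} [Fintype V] {H : SimpleGraph V}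
    [DecidableRel H.Adj] {c : ℝ} (hc : 0 < c) (h : HasRegularLocallyDenseBound.{u, v} H c) :
    HasRegularLocallyDenseBound.{u, v} H 1 := by
  have hpow : ∀ k : ℕ, HasRegularLocallyDenseBound.{u, v} H (c ^ ((1 / 2 : ℝ) ^ k)) := by
    intro k
    induction k with
    | zero => simpa using h
    | succ k ih =>
      have := ih.sqrt (Real.rpow_nonneg hc.le _)
      rwa [Real.sqrt_eq_rpow, ← Real.rpow_mul hc.le, ← pow_succ] at this
  intro Ω _ _ μ _ _ W p hW hreg
  have hlim : Filter.Tendsto (fun k : ℕ => c ^ ((1 / 2 : ℝ) ^ k) * p ^ H.edgeFinset.card)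
      Filter.atTop (nhds (c ^ (0 : ℝ) * p ^ H.edgeFinset.card)) := by
    refine Filter.Tendsto.mul_const _ ?_
    exact (Real.continuousAt_const_rpow hc.ne').tendsto.comp
      (tendsto_pow_atTop_nhds_zero_of_lt_one (by norm_num) (by norm_num))
  rw [Real.rpow_zero] at hlim
  exact le_of_tendsto hlim (.of_forall fun k => hpow k Ω μ W p hW hreg)

/-! ### Weak regularity -/

section FiberMean

variable {Z κ κ' : Type*} [Fintype Z] [DecidableEq κ] [DecidableEq κ']

/-- The mean of `A` over the fibre of `f` above `k` (zero if the fibre is empty). -/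
noncomputable def fiberMean (f : Z → κ) (A : Z → ℝ) (k : κ) : ℝ :=
  (∑ z with f z = k, A z) / (Finset.univ.filter fun z => f z = k).card

theorem card_mul_fiberMean (f : Z → κ) (A : Z → ℝ) (k : κ) :
    ((Finset.univ.filter fun z => f z = k).card : ℝ) * fiberMean f A k =
      ∑ z with f z = k, A z := by
  by_cases h : (Finset.univ.filter fun z => f z = k) = ∅
  · simp [h]
  · rw [fiberMean, mul_div_cancel₀]
    simpa using h

theorem fiberMean_mem_Icc {f : Z → κ} {A : Z → ℝ} (hA : ∀ z, A z ∈ Set.Icc (0 : ℝ) 1) (k : κ) :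
    fiberMean f A k ∈ Set.Icc (0 : ℝ) 1 := by
  refine ⟨div_nonneg (Finset.sum_nonneg fun z _ => (hA z).1) (Nat.cast_nonneg _),
    div_le_one_of_le₀ ?_ (Nat.cast_nonneg _)⟩
  simpa using Finset.sum_le_card_nsmul _ A 1 fun z _ => (hA z).2

theorem sum_comp_eq_sum_card_mul [Fintype κ] (f : Z → κ) (G : κ → ℝ) :
    ∑ z, G (f z) = ∑ k, ((Finset.univ.filter fun z => f z = k).card : ℝ) * G k := by
  rw [← Finset.sum_fiberwise _ f]
  refine Finset.sum_congr rfl fun k _ => ?_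
  rw [Finset.sum_congr rfl fun z hz => by rw [(Finset.mem_filter.1 hz).2], Finset.sum_const,
    nsmul_eq_mul]

/-- Taking fibre means is the orthogonal projection onto the functions that factor through `f`. -/
theorem sum_comp_mul_fiberMean [Fintype κ] (f : Z → κ) (A : Z → ℝ) (G : κ → ℝ) :
    ∑ z, G (f z) * fiberMean f A (f z) = ∑ z, G (f z) * A z := by
  rw [sum_comp_eq_sum_card_mul f fun k => G k * fiberMean f A k, ← Finset.sum_fiberwise _ f]
  refine Finset.sum_congr rfl fun k _ => ?_
  rw [mul_left_comm, card_mul_fiberMean, Finset.mul_sum]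
  exact Finset.sum_congr rfl fun z hz => by rw [(Finset.mem_filter.1 hz).2]

theorem fiberMean_comp_of_injective (f : Z → κ) (A : Z → ℝ) {e : κ → κ'}
    (he : Function.Injective e) (k : κ) : fiberMean (e ∘ f) A (e k) = fiberMean f A k := by
  simp [fiberMean, he.eq_iff]

/-- Pythagoras for the passage to a finer map. -/
theorem sum_fiberMean_sub_sq [Fintype κ] [Fintype κ'] (f : Z → κ) (r : κ → κ') (A : Z → ℝ) :
    ∑ z, (fiberMean f A (f z) - fiberMean (r ∘ f) A (r (f z))) ^ 2 =
      ∑ z, fiberMean f A (f z) ^ 2 - ∑ z, fiberMean (r ∘ f) A (r (f z)) ^ 2 := by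
  have h1 := sum_comp_mul_fiberMean f A fun k => fiberMean (r ∘ f) A (r k)
  have h2 := sum_comp_mul_fiberMean (r ∘ f) A fun k => fiberMean (r ∘ f) A k
  simp only [Function.comp_apply] at h2
  have h3 : ∑ z, (fiberMean f A (f z) - fiberMean (r ∘ f) A (r (f z))) ^ 2 =
      ∑ z, fiberMean f A (f z) ^ 2 -
        2 * ∑ z, fiberMean (r ∘ f) A (r (f z)) * fiberMean f A (f z) +
        ∑ z, fiberMean (r ∘ f) A (r (f z)) * fiberMean (r ∘ f) A (r (f z)) := by
    rw [Finset.mul_sum, ← Finset.sum_sub_distrib, ← Finset.sum_add_distrib]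
    exact Finset.sum_congr rfl fun z _ => by ring
  rw [h3, h1, ← h2]
  simp only [sq]
  ring

end FiberMean

section WeakRegularity

/-- The colouring `c` is `η`-regular for `A` in the cut norm: replacing `A` by its means over the
cells of `c` changes the sum over each rectangle by at most `η`. -/
def IsCutRegular {X κ : Type*} [Fintype X] [DecidableEq κ] (A : X × X → ℝ) (c : X → κ)
    (η : ℝ) : Prop :=
  ∀ S T : Finset X,
    |∑ z ∈ S ×ˢ T, (A z - fiberMean (Prod.map c c) A (Prod.map c c z))| ≤ η

theorem IsCutRegular.comp_injective {X κ κ' : Type*} [Fintype X] [DecidableEq κ]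
    [DecidableEq κ'] {A : X × X → ℝ} {c : X → κ} {η : ℝ} (h : IsCutRegular A c η)
    {e : κ → κ'} (he : Function.Injective e) : IsCutRegular A (e ∘ c) η := by
  intro S T
  have := fun z => fiberMean_comp_of_injective (Prod.map c c) A (he.prodMap he) (Prod.map c c z)
  rw [Prod.map_comp_map] at this
  simp only [Prod.map_map] at this
  simpa only [this] using h S T

/-- A colouring that is not regular has a refinement, with four times as many colours, whose energy
is larger by a definite amount. -/
theorem exists_energy_increment {X κ : Type*} [Fintype X] [Fintype κ] [DecidableEq κ]
    (A : X × X → ℝ) {c : X → κ} {ε : ℝ} (hε : 0 ≤ ε)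
    (h : ¬ IsCutRegular A c (ε * (Fintype.card X : ℝ) ^ 2)) :
    ∃ c' : X → κ × Bool × Bool,
      ∑ z, fiberMean (Prod.map c c) A (Prod.map c c z) ^ 2 + ε ^ 2 * (Fintype.card X : ℝ) ^ 2 ≤
        ∑ z, fiberMean (Prod.map c' c') A (Prod.map c' c' z) ^ 2 := by
  classical
  simp only [IsCutRegular, not_forall, not_le] at h
  obtain ⟨S, T, hST⟩ := h
  set n : ℝ := (Fintype.card X : ℝ)
  set c' : X → κ × Bool × Bool := fun x => (c x, decide (x ∈ S), decide (x ∈ T)) with hc'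
  refine ⟨c', ?_⟩
  set f := Prod.map c' c'
  set r : (κ × Bool × Bool) × (κ × Bool × Bool) → κ × κ := fun q => (q.1.1, q.2.1)
  have hr : r ∘ f = Prod.map c c := rfl
  have hpy := sum_fiberMean_sub_sq f r A
  rw [hr] at hpy
  change ∑ z, (fiberMean f A (f z) - fiberMean (Prod.map c c) A (Prod.map c c z)) ^ 2 =
    _ - ∑ z, fiberMean (Prod.map c c) A (Prod.map c c z) ^ 2 at hpy
  -- the rectangle `S × T` is a union of cells of the refinement
  set G : (κ × Bool × Bool) × (κ × Bool × Bool) → ℝ :=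
    fun q => if q.1.2.1 = true ∧ q.2.2.2 = true then 1 else 0 with hG
  have hGf : ∀ z : X × X, G (f z) = if z ∈ S ×ˢ T then 1 else 0 := by
    intro z
    simp [hG, f, hc', Finset.mem_product]
  have hproj := sum_comp_mul_fiberMean f A G
  have heq : ∑ z ∈ S ×ˢ T, (A z - fiberMean (Prod.map c c) A (Prod.map c c z)) =
      ∑ z, G (f z) * (fiberMean f A (f z) - fiberMean (Prod.map c c) A (Prod.map c c z)) := by
    simp only [mul_sub, Finset.sum_sub_distrib]
    rw [hproj]
    simp only [hGf, ite_mul, one_mul, zero_mul, Finset.sum_ite_mem, Finset.univ_inter]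
  have hcs := Finset.sum_mul_sq_le_sq_mul_sq Finset.univ (fun z => G (f z))
    (fun z => fiberMean f A (f z) - fiberMean (Prod.map c c) A (Prod.map c c z))
  rw [← heq, hpy] at hcs
  have hGsq : ∑ z, G (f z) ^ 2 ≤ n ^ 2 := by
    calc ∑ z, G (f z) ^ 2 ≤ ∑ _z : X × X, (1 : ℝ) := by
          refine Finset.sum_le_sum fun z _ => ?_
          rw [hGf]
          split_ifs <;> norm_num
      _ = n ^ 2 := by simp [n, sq]
  have hsq : (ε * n ^ 2) ^ 2 <
      (∑ z ∈ S ×ˢ T, (A z - fiberMean (Prod.map c c) A (Prod.map c c z))) ^ 2 := by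
    rw [← sq_abs (∑ z ∈ S ×ˢ T, _)]
    exact pow_lt_pow_left₀ hST (by positivity) two_ne_zero
  have hE : 0 ≤ ∑ z, fiberMean f A (f z) ^ 2 -
      ∑ z, fiberMean (Prod.map c c) A (Prod.map c c z) ^ 2 := by
    rw [← hpy]; positivity
  have hn : 0 < n ^ 2 := by
    rcases (sq_nonneg n).eq_or_lt with h0 | h0
    · rw [← h0] at hGsq
      nlinarith
    · exact h0
  have : n ^ 2 * (ε ^ 2 * n ^ 2) < n ^ 2 * (∑ z, fiberMean f A (f z) ^ 2 -
      ∑ z, fiberMean (Prod.map c c) A (Prod.map c c z) ^ 2) := by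
    nlinarith [mul_le_mul_of_nonneg_right hGsq hE]
  linarith [lt_of_mul_lt_mul_left this hn.le]

/-- The weak regularity lemma of Frieze and Kannan, with a number of cells depending on `ε` only. -/
theorem exists_isCutRegular {ε : ℝ} (hε : 0 < ε) : ∃ K : ℕ, ∀ (X : Type) [Fintype X] [Nonempty X]
    (A : X × X → ℝ), (∀ z, A z ∈ Set.Icc (0 : ℝ) 1) →
      ∃ c : X → Fin K, IsCutRegular A c (ε * (Fintype.card X : ℝ) ^ 2) := by
  obtain ⟨m, hm⟩ := exists_nat_gt (1 / ε ^ 2)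
  refine ⟨4 ^ m, fun X _ _ A hA => ?_⟩
  -- the energy is at most `|X|²`, so an increment of `ε² |X|²` can occur at most `1 / ε²` times
  have step : ∀ k : ℕ, ∃ c : X → Fin (4 ^ k), IsCutRegular A c (ε * (Fintype.card X : ℝ) ^ 2) ∨
      k * (ε ^ 2 * (Fintype.card X : ℝ) ^ 2) ≤
        ∑ z, fiberMean (Prod.map c c) A (Prod.map c c z) ^ 2 := by
    intro k
    induction k with
    | zero => exact ⟨fun _ => ⟨0, by simp⟩, Or.inr (by simpa using by positivity)⟩
    | succ k ih =>
      obtain ⟨c, hc⟩ := ih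
      by_cases hreg : IsCutRegular A c (ε * (Fintype.card X : ℝ) ^ 2)
      · exact ⟨Fin.castLE (Nat.pow_le_pow_right (by norm_num) k.le_succ) ∘ c,
          Or.inl (hreg.comp_injective (Fin.castLE_injective _))⟩
      · obtain ⟨c', hc'⟩ := exists_energy_increment A hε.le hreg
        have e : Fin (4 ^ k) × Bool × Bool ≃ Fin (4 ^ (k + 1)) :=
          Fintype.equivFinOfCardEq (by simp [pow_succ])
        refine ⟨e ∘ c', Or.inr ?_⟩
        have h1 := fun z => fiberMean_comp_of_injective (Prod.map c' c') A
          (e.injective.prodMap e.injective) (Prod.map c' c' z)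
        rw [Prod.map_comp_map] at h1
        simp only [Prod.map_map] at h1
        simp only [h1]
        have := hc.resolve_left hreg
        push_cast
        linarith
  obtain ⟨c, hc⟩ := step m
  refine ⟨c, hc.resolve_right fun h => ?_⟩
  have hle : ∑ z, fiberMean (Prod.map c c) A (Prod.map c c z) ^ 2 ≤ (Fintype.card X : ℝ) ^ 2 := by
    calc _ ≤ ∑ _z : X × X, (1 : ℝ) := Finset.sum_le_sum fun z _ =>
          pow_le_one₀ (fiberMean_mem_Icc hA _).1 (fiberMean_mem_Icc hA _).2
      _ = _ := by simp [sq]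
  have hn : (0 : ℝ) < (Fintype.card X : ℝ) ^ 2 := by
    have : 0 < Fintype.card X := Fintype.card_pos
    positivity
  have h2 : 1 < m * ε ^ 2 := (div_lt_iff₀ (by positivity)).1 hm
  nlinarith

end WeakRegularity

/-! ### The counting lemma -/

section Counting

theorem Graphon.onEdge_congr {V Ω : Type*} [MeasurableSpace Ω] (W : Graphon Ω) {x y : V → Ω}
    {e : Sym2 V} (h : ∀ v ∈ e, x v = y v) : W.onEdge x e = W.onEdge y e := by
  induction e with
  | _ u v =>
    change W.toFun (x u) (x v) = W.toFun (y u) (y v)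
    rw [h u (Sym2.mem_mk_left u v), h v (Sym2.mem_mk_right u v)]

variable {X : Type*} [Fintype X]

/-- A one-sided bound on the sums of `D` over rectangles extends to weights with values in
`[0, 1]`. -/
theorem sum_mul_sum_mul_le_of_forall_sum_product_le {D : X × X → ℝ} {η : ℝ}
    (h : ∀ S T : Finset X, ∑ z ∈ S ×ˢ T, D z ≤ η) {f g : X → ℝ}
    (hf : ∀ a, f a ∈ Set.Icc (0 : ℝ) 1) (hg : ∀ a, g a ∈ Set.Icc (0 : ℝ) 1) :
    ∑ a, ∑ b, f a * g b * D (a, b) ≤ η := by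
  classical
  -- a linear function on the cube is maximised by the indicator of its positive part
  have hmax : ∀ (f : X → ℝ) (_ : ∀ a, f a ∈ Set.Icc (0 : ℝ) 1) (l : X → ℝ),
      ∃ S : Finset X, ∑ a, f a * l a ≤ ∑ a ∈ S, l a := by
    intro f hf l
    refine ⟨Finset.univ.filter fun a => 0 ≤ l a, ?_⟩
    rw [Finset.sum_filter]
    refine Finset.sum_le_sum fun a _ => ?_
    split_ifs with ha
    · exact mul_le_of_le_one_left ha (hf a).2
    · exact mul_nonpos_of_nonneg_of_nonpos (hf a).1 (not_le.1 ha).le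
  obtain ⟨S, hS⟩ := hmax f hf fun a => ∑ b, g b * D (a, b)
  obtain ⟨T, hT⟩ := hmax g hg fun b => ∑ a ∈ S, D (a, b)
  calc ∑ a, ∑ b, f a * g b * D (a, b) = ∑ a, f a * ∑ b, g b * D (a, b) := by
        simp only [Finset.mul_sum, mul_assoc]
    _ ≤ ∑ a ∈ S, ∑ b, g b * D (a, b) := hS
    _ = ∑ b, g b * ∑ a ∈ S, D (a, b) := by
        rw [Finset.sum_comm]
        simp only [Finset.mul_sum]
    _ ≤ ∑ b ∈ T, ∑ a ∈ S, D (a, b) := hT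
    _ = ∑ z ∈ S ×ˢ T, D z := by rw [Finset.sum_product, Finset.sum_comm]
    _ ≤ η := h S T

theorem abs_sum_mul_sum_mul_le_of_forall_sum_product_le {D : X × X → ℝ} {η : ℝ}
    (h : ∀ S T : Finset X, |∑ z ∈ S ×ˢ T, D z| ≤ η) {f g : X → ℝ}
    (hf : ∀ a, f a ∈ Set.Icc (0 : ℝ) 1) (hg : ∀ a, g a ∈ Set.Icc (0 : ℝ) 1) :
    |∑ a, ∑ b, f a * g b * D (a, b)| ≤ η := by
  refine abs_le'.2 ⟨sum_mul_sum_mul_le_of_forall_sum_product_le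
    (fun S T => (le_abs_self _).trans (h S T)) hf hg, ?_⟩
  have := sum_mul_sum_mul_le_of_forall_sum_product_le (D := fun z => -D z) (η := η)
    (fun S T => by rw [Finset.sum_neg_distrib]; exact (neg_le_abs _).trans (h S T)) hf hg
  simpa only [mul_neg, Finset.sum_neg_distrib] using this

variable {V : Type*} [Fintype V] [DecidableEq V]

/-- Resampling one coordinate does not change the average of a function. -/
theorem sum_sum_update (G : (V → X) → ℝ) (u : V) :
    ∑ x, ∑ a, G (Function.update x u a) = Fintype.card X * ∑ x, G x := by
  have hinv : Function.Involutive fun q : (V → X) × X => (Function.update q.1 u q.2, q.1 u) := by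
    intro q
    simp
  have h1 := Equiv.sum_comp hinv.toPerm fun q : (V → X) × X => G q.1
  rw [Fintype.sum_prod_type, Fintype.sum_prod_type] at h1
  refine h1.trans ?_
  simp [Finset.mul_sum]

variable [MeasurableSpace X]

/-- Replacing a kernel by one that is close in the cut norm on a single edge: once all vertices but
the two ends of the edge are fixed, the other edges contribute a product of a function of one end
and a function of the other end. -/
theorem card_sq_mul_abs_sum_prod_mul_sub_le (W W' : Graphon X) {η : ℝ}
    (h : ∀ S T : Finset X, |∑ z ∈ S ×ˢ T, (W.toFun z.1 z.2 - W'.toFun z.1 z.2)| ≤ η)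
    (φ : Sym2 V → Graphon X) (E : Finset (Sym2 V)) {e₀ : Sym2 V} (he₀ : ¬ e₀.IsDiag)
    (hE : e₀ ∉ E) :
    (Fintype.card X : ℝ) ^ 2 *
        |∑ x : V → X, (∏ e ∈ E, (φ e).onEdge x e) * (W.onEdge x e₀ - W'.onEdge x e₀)| ≤
      η * (Fintype.card X : ℝ) ^ Fintype.card V := by
  induction e₀ with
  | _ u v =>
  have huv : u ≠ v := by simpa using he₀
  set G : (V → X) → ℝ := fun x =>
    (∏ e ∈ E, (φ e).onEdge x e) * (W.onEdge x s(u, v) - W'.onEdge x s(u, v)) with hG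
  have hres : ∑ x, ∑ a, ∑ b, G (Function.update (Function.update x u a) v b) =
      (Fintype.card X : ℝ) ^ 2 * ∑ x, G x := by
    rw [sum_sum_update (fun x => ∑ b, G (Function.update x v b)) u, sum_sum_update]
    ring
  have hpt : ∀ x, |∑ a, ∑ b, G (Function.update (Function.update x u a) v b)| ≤ η := by
    intro x
    set f : X → ℝ := fun a => ∏ e ∈ E with u ∈ e, (φ e).onEdge (Function.update x u a) e
    set g : X → ℝ := fun b => ∏ e ∈ E with u ∉ e, (φ e).onEdge (Function.update x v b) e
    have hf : ∀ a, f a ∈ Set.Icc (0 : ℝ) 1 := fun a =>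
      ⟨Finset.prod_nonneg fun e _ => ((φ e).onEdge_mem_Icc _ e).1,
        Finset.prod_le_one (fun e _ => ((φ e).onEdge_mem_Icc _ e).1)
          fun e _ => ((φ e).onEdge_mem_Icc _ e).2⟩
    have hg : ∀ b, g b ∈ Set.Icc (0 : ℝ) 1 := fun b =>
      ⟨Finset.prod_nonneg fun e _ => ((φ e).onEdge_mem_Icc _ e).1,
        Finset.prod_le_one (fun e _ => ((φ e).onEdge_mem_Icc _ e).1)
          fun e _ => ((φ e).onEdge_mem_Icc _ e).2⟩
    -- since `s(u, v) ∉ E`, no edge in `E` contains both `u` and `v`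
    have hGfg : ∀ a b, G (Function.update (Function.update x u a) v b) =
        f a * g b * (W.toFun a b - W'.toFun a b) := by
      intro a b
      have hW : ∀ W : Graphon X,
          W.onEdge (Function.update (Function.update x u a) v b) s(u, v) = W.toFun a b := by
        intro W
        change W.toFun (Function.update (Function.update x u a) v b u)
          (Function.update (Function.update x u a) v b v) = _
        simp [huv]
      simp only [hG, hW]
      congr 1
      rw [← Finset.prod_filter_mul_prod_filter_not E (fun e => u ∈ e)]
      congr 1
      · refine Finset.prod_congr rfl fun e he => (φ e).onEdge_congr fun w hw => ?_
        rw [Finset.mem_filter] at he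
        refine Function.update_of_ne ?_ _ _
        rintro rfl
        exact hE (((Sym2.mem_and_mem_iff huv).1 ⟨he.2, hw⟩) ▸ he.1)
      · refine Finset.prod_congr rfl fun e he => (φ e).onEdge_congr fun w hw => ?_
        rw [Finset.mem_filter] at he
        have hwu : w ≠ u := by
          rintro rfl
          exact he.2 hw
        by_cases hwv : w = v
        · subst hwv
          simp
        · simp [hwv, hwu]
    simp only [hGfg]
    exact abs_sum_mul_sum_mul_le_of_forall_sum_product_le
      (D := fun z => W.toFun z.1 z.2 - W'.toFun z.1 z.2) h hf hg
  have habs : (Fintype.card X : ℝ) ^ 2 * |∑ x, G x| =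
      |∑ x, ∑ a, ∑ b, G (Function.update (Function.update x u a) v b)| := by
    rw [hres, abs_mul, abs_of_nonneg (by positivity : (0 : ℝ) ≤ (Fintype.card X : ℝ) ^ 2)]
  rw [habs]
  refine (Finset.abs_sum_le_sum_abs _ _).trans ((Finset.sum_le_sum fun x _ => hpt x).trans ?_)
  simp [mul_comm]

/-- The counting lemma: homomorphism sums are Lipschitz in the cut norm. -/
theorem card_sq_mul_abs_sum_prod_sub_sum_prod_le (W W' : Graphon X) {η : ℝ}
    (h : ∀ S T : Finset X, |∑ z ∈ S ×ˢ T, (W.toFun z.1 z.2 - W'.toFun z.1 z.2)| ≤ η)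
    (E : Finset (Sym2 V)) (hE : ∀ e ∈ E, ¬ e.IsDiag) :
    (Fintype.card X : ℝ) ^ 2 *
        |∑ x : V → X, ∏ e ∈ E, W.onEdge x e - ∑ x : V → X, ∏ e ∈ E, W'.onEdge x e| ≤
      E.card * (η * (Fintype.card X : ℝ) ^ Fintype.card V) := by
  -- the kernels are exchanged one edge at a time
  set φ : Finset (Sym2 V) → Sym2 V → Graphon X := fun s e => if e ∈ s then W else W' with hφ
  have key : ∀ s ⊆ E, (Fintype.card X : ℝ) ^ 2 *
        |∑ x : V → X, ∏ e ∈ E, (φ s e).onEdge x e - ∑ x : V → X, ∏ e ∈ E, W'.onEdge x e| ≤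
      s.card * (η * (Fintype.card X : ℝ) ^ Fintype.card V) := by
    intro s
    induction s using Finset.induction_on with
    | empty => simp [hφ]
    | insert e₀ s hes ih =>
      intro hsub
      have he₀ := hsub (Finset.mem_insert_self e₀ s)
      have h1 := ih ((Finset.subset_insert e₀ s).trans hsub)
      have h2 := card_sq_mul_abs_sum_prod_mul_sub_le W W' h (φ s) (E.erase e₀) (hE e₀ he₀)
        (Finset.notMem_erase e₀ E)
      have h3 : ∑ x : V → X, ∏ e ∈ E, (φ (insert e₀ s) e).onEdge x e -
          ∑ x : V → X, ∏ e ∈ E, (φ s e).onEdge x e = ∑ x : V → X,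
            (∏ e ∈ E.erase e₀, (φ s e).onEdge x e) * (W.onEdge x e₀ - W'.onEdge x e₀) := by
        rw [← Finset.sum_sub_distrib]
        refine Finset.sum_congr rfl fun x _ => ?_
        rw [← Finset.mul_prod_erase E _ he₀, ← Finset.mul_prod_erase E _ he₀]
        have h4 : ∏ e ∈ E.erase e₀, (φ (insert e₀ s) e).onEdge x e =
            ∏ e ∈ E.erase e₀, (φ s e).onEdge x e := by
          refine Finset.prod_congr rfl fun e he => ?_
          simp [hφ, Finset.ne_of_mem_erase he]
        rw [h4]
        simp only [hφ, Finset.mem_insert_self, if_true, hes, if_false]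
        ring
      rw [← h3] at h2
      rw [Finset.card_insert_of_notMem hes]
      push_cast
      have h5 := abs_sub_le (∑ x : V → X, ∏ e ∈ E, (φ (insert e₀ s) e).onEdge x e)
        (∑ x : V → X, ∏ e ∈ E, (φ s e).onEdge x e) (∑ x : V → X, ∏ e ∈ E, W'.onEdge x e)
      have h6 := mul_le_mul_of_nonneg_left h5 (sq_nonneg (Fintype.card X : ℝ))
      linarith
  have hE' : ∀ x : V → X, ∏ e ∈ E, (φ E e).onEdge x e = ∏ e ∈ E, W.onEdge x e := fun x =>
    Finset.prod_congr rfl fun e he => by simp [hφ, he]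
  simpa only [hE'] using key E subset_rfl

end Counting

/-! ### Quotients of finite graphs -/

/-- A quadratic form whose matrix has nonpositive diagonal is concave in each coordinate, so on the
cube `[0, 1]^X` it is bounded below by its minimum over the vertices. -/
theorem le_sum_mul_mul_of_forall_finset {X : Type*} [Fintype X] {B : X → X → ℝ} {L : ℝ}
    (hdiag : ∀ x, B x x ≤ 0) (hL : ∀ S : Finset X, L ≤ ∑ x ∈ S, ∑ y ∈ S, B x y) {f : X → ℝ}
    (hf : ∀ x, f x ∈ Set.Icc (0 : ℝ) 1) : L ≤ ∑ x, ∑ y, f x * f y * B x y := by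
  classical
  have key : ∀ (s : Finset X) (f : X → ℝ), (∀ x, f x ∈ Set.Icc (0 : ℝ) 1) →
      (∀ x ∉ s, f x = 0 ∨ f x = 1) → L ≤ ∑ x, ∑ y, f x * f y * B x y := by
    intro s
    induction s using Finset.induction_on with
    | empty =>
      intro f _ h01
      convert hL (Finset.univ.filter fun x => f x = 1) using 1
      simp only [Finset.sum_filter]
      refine Finset.sum_congr rfl fun x _ => ?_
      rcases h01 x (Finset.notMem_empty x) with hx | hx
      · simp [hx]
      · simp only [hx, if_true, one_mul]
        refine Finset.sum_congr rfl fun y _ => ?_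
        rcases h01 y (Finset.notMem_empty y) with hy | hy <;> simp [hy]
    | insert v s hv ih =>
      intro f hf h01
      have hup : ∀ t : ℝ, t = 0 ∨ t = 1 →
          L ≤ ∑ x, ∑ y, Function.update f v t x * Function.update f v t y * B x y := by
        intro t ht
        refine ih _ (fun x => ?_) fun x hx => ?_
        · by_cases hxv : x = v
          · subst hxv
            rcases ht with rfl | rfl <;> simp
          · simpa [hxv] using hf x
        · by_cases hxv : x = v
          · subst hxv
            simpa using ht
          · simpa [hxv] using h01 x (by simp [hxv, hx])
      have h0 := hup 0 (Or.inl rfl)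
      have h1 := hup 1 (Or.inr rfl)
      set t := f v with ht
      have hid : (1 - t) * ∑ x, ∑ y, Function.update f v 0 x * Function.update f v 0 y * B x y +
          t * ∑ x, ∑ y, Function.update f v 1 x * Function.update f v 1 y * B x y =
          ∑ x, ∑ y, f x * f y * B x y + t * (1 - t) * B v v := by
        have hlast : t * (1 - t) * B v v =
            ∑ x, ∑ y, if x = v ∧ y = v then t * (1 - t) * B x y else 0 := by
          rw [Finset.sum_eq_single v, Finset.sum_eq_single v] <;> simp +contextual
        rw [hlast]
        simp only [Finset.mul_sum, ← Finset.sum_add_distrib]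
        refine Finset.sum_congr rfl fun x _ => Finset.sum_congr rfl fun y _ => ?_
        by_cases hx : x = v <;> by_cases hy : y = v <;> simp [hx, hy, ← ht] <;> ring
      have hft := hf v
      rw [← ht] at hft
      have h2 : t * (1 - t) * B v v ≤ 0 :=
        mul_nonpos_of_nonneg_of_nonpos (mul_nonneg hft.1 (by linarith [hft.2])) (hdiag v)
      nlinarith [mul_le_mul_of_nonneg_left h0 (by linarith [hft.2] : 0 ≤ 1 - t),
        mul_le_mul_of_nonneg_left h1 hft.1]
  exact key Finset.univ f hf fun x hx => absurd (Finset.mem_univ x) hx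

namespace Graphon

/-- The pullback `(x, y) ↦ M(c(x), c(y))` of a kernel along a measurable map. -/
def comap {Ω κ : Type*} [MeasurableSpace Ω] [MeasurableSpace κ] (M : Graphon κ)
    (c : Ω → κ) (hc : Measurable c) :
    Graphon Ω where
  toFun x y := M.toFun (c x) (c y)
  measurable' := M.measurable'.comp (hc.prodMap hc)
  symm' _ _ := M.symm' _ _
  mem_Icc' _ _ := M.mem_Icc' _ _

theorem onEdge_comap {V Ω κ : Type*} [MeasurableSpace Ω] [MeasurableSpace κ]
    (M : Graphon κ) (c : Ω → κ)
    (hc : Measurable c) (x : V → Ω) (e : Sym2 V) :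
    (M.comap c hc).onEdge x e = M.onEdge (c ∘ x) e := by
  induction e with | _ u v => rfl

section CellWeight

variable {X κ : Type*} [Fintype X] [DecidableEq κ]

/-- The proportion of elements of colour `i`. -/
noncomputable def cellWeight (c : X → κ) (i : κ) : ℝ :=
  ((Finset.univ.filter fun x => c x = i).card : ℝ) / Fintype.card X

theorem card_mul_cellWeight [Nonempty X] (c : X → κ) (i : κ) :
    (Fintype.card X : ℝ) * cellWeight c i = (Finset.univ.filter fun x => c x = i).card :=
  mul_div_cancel₀ _ (by simp)

theorem cellWeight_nonneg (c : X → κ) (i : κ) : 0 ≤ cellWeight c i := by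
  unfold cellWeight; positivity

theorem sum_cellWeight [Nonempty X] [Fintype κ] (c : X → κ) : ∑ i, cellWeight c i = 1 := by
  have h := sum_comp_eq_sum_card_mul c fun _ => (1 : ℝ)
  simp only [Finset.sum_const, Finset.card_univ, nsmul_eq_mul, mul_one] at h
  unfold cellWeight
  rw [← Finset.sum_div, ← h, div_self (by simp)]

end CellWeight

variable {V κ : Type*} [Fintype V] [Fintype κ] [MeasurableSpace κ]

open Classical in
/-- The homomorphism density of `H` in a kernel `M` on a finite set with vertex weights `w`. -/
noncomputable def weightedHomDensity (H : SimpleGraph V) [DecidableRel H.Adj] (w : κ → ℝ)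
    (M : Graphon κ) : ℝ :=
  ∑ i : V → κ, (∏ v, w (i v)) * ∏ e ∈ H.edgeFinset, M.onEdge i e

theorem sum_prod_onEdge_comap [DecidableEq V] {X : Type*} [Fintype X]
    [MeasurableSpace X] [Nonempty X] [DecidableEq κ] (H : SimpleGraph V) [DecidableRel H.Adj]
    (M : Graphon κ) {c : X → κ} (hc : Measurable c) :
    ∑ x : V → X, ∏ e ∈ H.edgeFinset, (M.comap c hc).onEdge x e =
      (Fintype.card X : ℝ) ^ Fintype.card V * weightedHomDensity H (cellWeight c) M := by
  classical
  simp only [onEdge_comap]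
  rw [sum_comp_eq_sum_card_mul (fun x : V → X => c ∘ x)
    fun i => ∏ e ∈ H.edgeFinset, M.onEdge i e, weightedHomDensity, Finset.mul_sum]
  refine Finset.sum_congr (by congr!) fun i _ => ?_
  have h : (Finset.univ.filter fun x : V → X => c ∘ x = i) =
      Fintype.piFinset fun v => Finset.univ.filter fun a => c a = i v := by
    ext x
    simp [funext_iff]
  rw [h, Fintype.card_piFinset, Nat.cast_prod]
  simp only [← card_mul_cellWeight]
  rw [Finset.prod_mul_distrib, Finset.prod_const, Finset.card_univ, mul_assoc]

variable {X : Type*} [Fintype X] [MeasurableSpace X] [DecidableEq κ] [MeasurableSingletonClass κ]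

/-- The quotient of a kernel on a finite set by a colouring: its means over pairs of cells. -/
noncomputable def quotient (A : Graphon X) (c : X → κ) : Graphon κ where
  toFun i j := fiberMean (Prod.map c c) (Function.uncurry A.toFun) (i, j)
  measurable' := measurable_of_finite _
  symm' i j := by
    have h : ∀ g : X × X → ℝ, (∀ z, g z = g z.swap) →
        ∑ z with Prod.map c c z = (i, j), g z = ∑ z with Prod.map c c z = (j, i), g z := by
      intro g hg
      refine Finset.sum_equiv (Equiv.prodComm X X) (fun z => ?_) fun z _ => hg z
      simp [Prod.ext_iff, and_comm]
    have h1 := h (fun _ => 1) fun _ => rfl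
    have h2 := h (Function.uncurry A.toFun) fun z => A.symm' _ _
    simp only [Finset.sum_const, nsmul_eq_mul, mul_one] at h1
    rw [fiberMean, fiberMean, h1, h2]
  mem_Icc' i j := fiberMean_mem_Icc (fun z : X × X => A.mem_Icc' z.1 z.2) _

variable [Nonempty X]

theorem sum_comp_mul_eq_sum_cellWeight (A : Graphon X) (c : X → κ) (G : κ → κ → ℝ) :
    ∑ x, ∑ y, G (c x) (c y) * A.toFun x y = (Fintype.card X : ℝ) ^ 2 *
      ∑ i, ∑ j, cellWeight c i * cellWeight c j * (G i j * (A.quotient c).toFun i j) := by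
  have h1 := sum_comp_mul_fiberMean (Prod.map c c) (Function.uncurry A.toFun)
    (fun k => G k.1 k.2)
  have h2 := sum_comp_eq_sum_card_mul (Prod.map c c) fun k => G k.1 k.2 *
    fiberMean (Prod.map c c) (Function.uncurry A.toFun) k
  rw [h1, Fintype.sum_prod_type, Fintype.sum_prod_type] at h2
  refine h2.trans ?_
  simp only [Finset.mul_sum]
  refine Finset.sum_congr rfl fun i _ => Finset.sum_congr rfl fun j _ => ?_
  have h3 : (Finset.univ.filter fun z : X × X => Prod.map c c z = (i, j)) =
      (Finset.univ.filter fun x => c x = i) ×ˢ (Finset.univ.filter fun x => c x = j) := by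
    ext z
    simp [Prod.ext_iff]
  rw [h3, Finset.card_product, Nat.cast_mul, ← card_mul_cellWeight, ← card_mul_cellWeight]
  change _ * (G i j * (A.quotient c).toFun i j) = _
  ring

/-- Passing to the quotient by a regular colouring hardly changes homomorphism densities. -/
theorem weightedHomDensity_quotient_le (H : SimpleGraph V) [DecidableRel H.Adj] [DecidableEq V]
    (A : Graphon X) {c : X → κ} (hc : Measurable c) {ε : ℝ}
    (h : IsCutRegular (Function.uncurry A.toFun) c (ε * (Fintype.card X : ℝ) ^ 2)) :
    weightedHomDensity H (cellWeight c) (A.quotient c) ≤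
      (∑ x : V → X, ∏ e ∈ H.edgeFinset, A.onEdge x e) / (Fintype.card X : ℝ) ^ Fintype.card V +
        H.edgeFinset.card * ε := by
  have hn : (0 : ℝ) < Fintype.card X := by exact_mod_cast Fintype.card_pos
  have key := card_sq_mul_abs_sum_prod_sub_sum_prod_le (V := V) A ((A.quotient c).comap c hc)
    (η := ε * (Fintype.card X : ℝ) ^ 2) h H.edgeFinset
    fun e he => H.not_isDiag_of_mem_edgeSet (SimpleGraph.mem_edgeFinset.1 he)
  rw [sum_prod_onEdge_comap] at key
  have hN : (0 : ℝ) < (Fintype.card X : ℝ) ^ Fintype.card V := by positivity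
  have h1 : |∑ x : V → X, ∏ e ∈ H.edgeFinset, A.onEdge x e - (Fintype.card X : ℝ) ^ Fintype.card V *
      weightedHomDensity H (cellWeight c) (A.quotient c)| ≤
      H.edgeFinset.card * ε * (Fintype.card X : ℝ) ^ Fintype.card V := by
    refine le_of_mul_le_mul_left (key.trans_eq ?_) (by positivity : 0 < (Fintype.card X : ℝ) ^ 2)
    ring
  have h2 := (abs_le.1 h1).1
  rw [div_add' _ _ _ hN.ne', le_div_iff₀ hN]
  linarith

end Graphon

namespace SimpleGraph

variable {X : Type*} [Fintype X] [MeasurableSpace X] [MeasurableSingletonClass X]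

/-- The adjacency matrix of a finite graph, as a graphon on its vertex set. -/
noncomputable def toGraphon (G : SimpleGraph X) : Graphon X := by
  classical exact
  { toFun := fun x y => if G.Adj x y then 1 else 0
    measurable' := measurable_of_finite _
    symm' := fun x y => by simp [G.adj_comm]
    mem_Icc' := fun x y => by split_ifs <;> simp }

theorem toGraphon_apply (G : SimpleGraph X) [DecidableRel G.Adj] (x y : X) :
    G.toGraphon.toFun x y = if G.Adj x y then 1 else 0 := by
  simp only [toGraphon]
  congr

theorem homDensity_eq_sum_prod {V : Type*} [Fintype V] [DecidableEq V] (H : SimpleGraph V)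
    [DecidableRel H.Adj] (G : SimpleGraph X) :
    H.homDensity G = (∑ x : V → X, ∏ e ∈ H.edgeFinset, G.toGraphon.onEdge x e) /
      (Fintype.card X : ℝ) ^ Fintype.card V := by
  classical
  rw [homDensity, Nat.card_eq_fintype_card, Nat.card_eq_fintype_card, Nat.card_eq_fintype_card]
  congr 1
  have h1 : ∀ (x : V → X) (e : Sym2 V),
      G.toGraphon.onEdge x e = if e.map x ∈ G.edgeSet then 1 else 0 := by
    intro x e
    induction e with | _ u v => exact toGraphon_apply G _ _
  have h2 : ∀ x : V → X, ∏ e ∈ H.edgeFinset, G.toGraphon.onEdge x e =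
      if ∀ e ∈ H.edgeSet, e.map x ∈ G.edgeSet then 1 else 0 := by
    intro x
    simp only [h1]
    rw [Finset.prod_boole]
    simp only [mem_edgeFinset]
  simp only [h2]
  rw [Finset.sum_boole, Nat.cast_inj, ← Fintype.card_subtype, ← Nat.card_eq_fintype_card,
    ← Nat.card_eq_fintype_card]
  refine Nat.card_congr
    { toFun := fun f => ⟨f, fun e he => ?_⟩
      invFun := fun x => ⟨x.1, fun {u v} huv => x.2 s(u, v) (by simpa using huv)⟩
      left_inv := fun f => rfl
      right_inv := fun x => rfl }
  induction e with | _ u v => exact f.map_rel (by simpa using he)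

theorem sum_toGraphon_eq_two_mul (G : SimpleGraph X) (S : Finset X) :
    ∑ x ∈ S, ∑ y ∈ S, G.toGraphon.toFun x y =
      2 * ((G.induce (S : Set X)).edgeSet.ncard : ℝ) := by
  classical
  have h := (G.induce (S : Set X)).sum_degrees_eq_twice_card_edges
  rw [← Set.ncard_coe_finset, coe_edgeFinset] at h
  rw [← Nat.cast_ofNat (n := 2), ← Nat.cast_mul, ← h, Nat.cast_sum]
  rw [← Finset.sum_coe_sort S]
  refine Finset.sum_congr rfl fun x _ => ?_
  rw [← Finset.sum_coe_sort S, ← card_neighborFinset_eq_degree, neighborFinset_eq_filter]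
  simp [toGraphon_apply, Finset.sum_boole]

theorem sum_toGraphon_eq_ncard_neighborSet (G : SimpleGraph X) (x : X) :
    ∑ y, G.toGraphon.toFun x y = (G.neighborSet x).ncard := by
  classical
  simp only [toGraphon_apply, Finset.sum_boole]
  rw [← Set.ncard_coe_finset]
  congr 2
  ext y
  simp

variable {κ : Type*} [Fintype κ] [DecidableEq κ] [MeasurableSpace κ] [MeasurableSingletonClass κ]
  [Nonempty X]

/-- Local density of a finite graph passes to the quotients of its adjacency matrix, up to
`p δ²`. -/
theorem IsLocallyDense.le_sum_quotient {G : SimpleGraph X} {p δ : ℝ} (hp : 0 ≤ p)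
    (hG : G.IsLocallyDense p δ) (c : X → κ) {f : κ → ℝ}
    (hf : ∀ i, f i ∈ Set.Icc 0 (Graphon.cellWeight c i)) :
    p * (∑ i, f i) ^ 2 - p * δ ^ 2 ≤
      ∑ i, ∑ j, f i * f j * (G.toGraphon.quotient c).toFun i j := by
  classical
  set n : ℝ := (Fintype.card X : ℝ) with hn
  have hn0 : 0 < n := by rw [hn]; exact_mod_cast Fintype.card_pos (α := X)
  set w := Graphon.cellWeight c with hw
  -- the junk value `0 / 0 = 0` is right on empty cells, where `f` vanishes
  set d : κ → ℝ := fun i => f i / w i with hd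
  have hdw : ∀ i, w i * d i = f i := by
    intro i
    rcases eq_or_ne (w i) 0 with h | h
    · have := hf i
      rw [h] at this
      rw [h, zero_mul, le_antisymm this.2 this.1]
    · rw [hd, mul_div_cancel₀ _ h]
  have hd01 : ∀ i, d i ∈ Set.Icc (0 : ℝ) 1 := fun i =>
    ⟨div_nonneg (hf i).1 ((hf i).1.trans (hf i).2),
      div_le_one_of_le₀ (hf i).2 ((hf i).1.trans (hf i).2)⟩
  have key := le_sum_mul_mul_of_forall_finset (B := fun x y => G.toGraphon.toFun x y - p)
    -- sets with fewer than `δ n` elements, on which nothing is assumed, cost at most `p (δ n)²`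
    (L := -(p * δ ^ 2 * n ^ 2)) (fun x => by simp [toGraphon_apply, hp]) (fun S => by
      have h1 := hG S
      rw [Set.ncard_coe_finset, Nat.card_eq_fintype_card] at h1
      simp only [Finset.sum_sub_distrib, sum_toGraphon_eq_two_mul, Finset.sum_const, nsmul_eq_mul]
      rcases le_or_gt (δ * n) (S.card : ℝ) with h | h
      · nlinarith [h1 h, mul_nonneg hp (sq_nonneg (δ * n))]
      · have h2 : (S.card : ℝ) ^ 2 ≤ (δ * n) ^ 2 := by gcongr
        have h3 : (0 : ℝ) ≤ ((G.induce (S : Set X)).edgeSet.ncard : ℝ) := Nat.cast_nonneg _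
        nlinarith [mul_le_mul_of_nonneg_left h2 hp])
    (f := fun x => d (c x)) fun x => hd01 _
  have e1 := Graphon.sum_comp_mul_eq_sum_cellWeight G.toGraphon c fun i j => d i * d j
  have e2 : ∑ x, d (c x) = n * ∑ i, f i := by
    rw [sum_comp_eq_sum_card_mul c d, Finset.mul_sum]
    refine Finset.sum_congr rfl fun i _ => ?_
    rw [← Graphon.card_mul_cellWeight, mul_assoc, hdw]
  have e3 : ∑ x, ∑ y, d (c x) * d (c y) * (G.toGraphon.toFun x y - p) =
      ∑ x, ∑ y, d (c x) * d (c y) * G.toGraphon.toFun x y - p * (∑ x, d (c x)) ^ 2 := by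
    rw [sq, Finset.sum_mul_sum, Finset.mul_sum, ← Finset.sum_sub_distrib]
    refine Finset.sum_congr rfl fun i _ => ?_
    rw [Finset.mul_sum, ← Finset.sum_sub_distrib]
    exact Finset.sum_congr rfl fun j _ => by ring
  have e4 : ∑ i, ∑ j, w i * w j * (d i * d j * (G.toGraphon.quotient c).toFun i j) =
      ∑ i, ∑ j, f i * f j * (G.toGraphon.quotient c).toFun i j := by
    refine Finset.sum_congr rfl fun i _ => Finset.sum_congr rfl fun j _ => ?_
    rw [← hdw i, ← hdw j]
    ring
  rw [e4] at e1
  rw [e3, e1, e2] at key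
  have h5 : 0 < n ^ 2 := by positivity
  nlinarith [key]

/-- Near-regularity of a finite graph passes to the quotients of its adjacency matrix. -/
theorem IsNearlyRegular.abs_sum_quotient_sub_le {G : SimpleGraph X} {p δ : ℝ}
    (hp : p ∈ Set.Icc (0 : ℝ) 1) (hδ : 0 ≤ δ) (hG : G.IsNearlyRegular p δ) (c : X → κ) (i : κ) :
    |∑ j, Graphon.cellWeight c i * Graphon.cellWeight c j * (G.toGraphon.quotient c).toFun i j -
      p * Graphon.cellWeight c i| ≤ 2 * δ := by
  classical
  set n : ℝ := (Fintype.card X : ℝ) with hn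
  have hn0 : 0 < n := by rw [hn]; exact_mod_cast Fintype.card_pos (α := X)
  set w := Graphon.cellWeight c with hw
  set deg : X → ℝ := fun x => ∑ y, G.toGraphon.toFun x y with hdeg
  have hdeg01 : ∀ x, deg x ∈ Set.Icc 0 n := fun x => by
    refine ⟨Finset.sum_nonneg fun y _ => (G.toGraphon.mem_Icc' x y).1, ?_⟩
    simpa using Finset.sum_le_card_nsmul Finset.univ _ 1 fun y _ => (G.toGraphon.mem_Icc' x y).2
  set bad : Finset X := Finset.univ.filter fun x =>
    deg x ∉ Set.Icc ((p - δ) * n) ((p + δ) * n) with hbad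
  have hbadcard : (bad.card : ℝ) ≤ δ * n := by
    have h := hG
    unfold IsNearlyRegular at h
    rw [Nat.card_eq_fintype_card] at h
    convert h using 2
    rw [← Set.ncard_coe_finset]
    congr 1
    ext x
    simp only [hbad, hdeg, sum_toGraphon_eq_ncard_neighborSet, Finset.coe_filter,
      Finset.mem_univ, true_and]
    rfl
  have hpt : ∀ x, |deg x - p * n| ≤ δ * n + if x ∈ bad then n else 0 := by
    intro x
    have h0 := hdeg01 x
    have hpn : 0 ≤ p * n := mul_nonneg hp.1 hn0.le
    have hpn' : p * n ≤ n := mul_le_of_le_one_left hn0.le hp.2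
    have hδn : 0 ≤ δ * n := mul_nonneg hδ hn0.le
    split_ifs with hx
    · exact abs_le.2 ⟨by linarith [h0.1], by linarith [h0.2]⟩
    · have h1 : deg x ∈ Set.Icc ((p - δ) * n) ((p + δ) * n) := by simpa [hbad] using hx
      exact abs_le.2 ⟨by linarith [h1.1], by linarith [h1.2]⟩
  have e1 := Graphon.sum_comp_mul_eq_sum_cellWeight G.toGraphon c
    fun k _ => if k = i then 1 else 0
  have e2 : ∑ x, ∑ y, (if c x = i then 1 else 0) * G.toGraphon.toFun x y =
      ∑ x, if c x = i then deg x else 0 := by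
    refine Finset.sum_congr rfl fun x _ => ?_
    split_ifs <;> simp [hdeg]
  have e3 : ∑ k, ∑ j, w k * w j * ((if k = i then 1 else 0) * (G.toGraphon.quotient c).toFun k j) =
      ∑ j, w i * w j * (G.toGraphon.quotient c).toFun i j := by
    rw [Finset.sum_eq_single i] <;> simp +contextual
  rw [e2, e3] at e1
  have e4 : ∑ x, (if c x = i then p * n else 0) = n ^ 2 * (p * w i) := by
    rw [← Finset.sum_filter, Finset.sum_const, nsmul_eq_mul, ← Graphon.card_mul_cellWeight]
    ring
  have h1 : |∑ x, (if c x = i then deg x else 0) - ∑ x, (if c x = i then p * n else 0)| ≤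
      n ^ 2 * (2 * δ) := by
    rw [← Finset.sum_sub_distrib]
    calc _ ≤ ∑ x, |(if c x = i then deg x else 0) - (if c x = i then p * n else 0)| :=
          Finset.abs_sum_le_sum_abs _ _
      _ ≤ ∑ x, (δ * n + if x ∈ bad then n else 0) := by
          refine Finset.sum_le_sum fun x _ => ?_
          split_ifs with hx hb hb
          · simpa [hb] using hpt x
          · simpa [hb] using hpt x
          · simp only [sub_zero, abs_zero]; positivity
          · simp only [sub_zero, abs_zero]; positivity
      _ = n * (δ * n) + bad.card * n := by
          rw [Finset.sum_add_distrib, Finset.sum_ite_mem, Finset.univ_inter]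
          simp [hn]
      _ ≤ n ^ 2 * (2 * δ) := by nlinarith
  rw [e1, e4, ← mul_sub, abs_mul, abs_of_pos (by positivity)] at h1
  exact le_of_mul_le_mul_left h1 (by positivity)

end SimpleGraph

/-! ### Step graphons and the limit argument -/

theorem MeasurableEquiv.standardBorelSpace {α β : Type*} [MeasurableSpace α] [MeasurableSpace β]
    [h : StandardBorelSpace β] (e : α ≃ᵐ β) : StandardBorelSpace α := by
  obtain ⟨_, hb, _⟩ := h.polish
  refine ⟨TopologicalSpace.induced e inferInstance, @BorelSpace.mk _ (_) _ ?_,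
    e.toEquiv.polishSpace_induced⟩
  rw [borel_comap, ← hb.measurable_eq, e.measurableEmbedding.comap_eq]

/-- Every probability vector is the distribution of a random variable on an atomless standard
probability space, in any universe. -/
theorem exists_atomless_measure_preimage_eq {κ : Type} [Fintype κ] [MeasurableSpace κ]
    [MeasurableSingletonClass κ] {w : κ → ℝ} (hw : ∀ i, 0 ≤ w i) (hsum : ∑ i, w i = 1) :
    ∃ (Ω : Type u) (_ : MeasurableSpace Ω) (_ : StandardBorelSpace Ω) (μ : Measure Ω)
      (_ : IsProbabilityMeasure μ) (_ : NullSingletonClass μ) (π : Ω → κ), Measurable π ∧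
      ∀ i, μ.real (π ⁻¹' {i}) = w i := by
  set ν : Measure κ := ∑ i, ENNReal.ofReal (w i) • Measure.dirac i with hν
  have hνi : ∀ i, ν {i} = ENNReal.ofReal (w i) := by
    intro i
    simp only [hν, Measure.finsetSum_apply, Measure.smul_apply, smul_eq_mul]
    rw [Finset.sum_eq_single i]
    · simp
    · intro j _ hj
      simp [hj]
    · simp
  have hνp : IsProbabilityMeasure ν := ⟨by
    simp [hν, ← ENNReal.ofReal_sum_of_nonneg fun i _ => hw i, hsum]⟩
  let e : ULift.{u} (κ × unitInterval) ≃ᵐ κ × unitInterval := MeasurableEquiv.ulift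
  set P : Measure (κ × unitInterval) := ν.prod volume with hP
  refine ⟨ULift.{u} (κ × unitInterval), inferInstance, e.standardBorelSpace, P.map e.symm,
    Measure.isProbabilityMeasure_map e.symm.measurable.aemeasurable, ⟨fun x => ?_⟩,
    fun x => (e x).1, measurable_fst.comp e.measurable, fun i => ?_⟩
  · rw [e.symm.map_apply]
    refine Set.Subsingleton.measure_zero (fun a ha b hb => e.symm.injective ?_) _
    rw [Set.mem_preimage, Set.mem_singleton_iff] at ha hb
    rw [ha, hb]
  · rw [measureReal_def, e.symm.map_apply]
    have : e.symm ⁻¹' ((fun x => (e x).1) ⁻¹' {i}) = {i} ×ˢ Set.univ := by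
      ext z
      simp
    rw [this, hP, Measure.prod_prod, hνi, measure_univ, mul_one, ENNReal.toReal_ofReal (hw i)]

namespace Graphon

variable {Ω κ : Type*} [MeasurableSpace Ω] [Fintype κ] [MeasurableSpace κ]
  [MeasurableSingletonClass κ] {μ : Measure Ω} [IsProbabilityMeasure μ] {π : Ω → κ}

theorem homDensity_comap {V : Type*} [Fintype V] (H : SimpleGraph V) [DecidableRel H.Adj]
    (M : Graphon κ) (hπ : Measurable π) :
    (M.comap π hπ).homDensity H μ =
      weightedHomDensity H (fun i => μ.real (π ⁻¹' {i})) M := by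
  classical
  have h := integral_comp_eq_sum (m := Measure.pi fun _ : V => μ) (f := fun x v => π (x v))
    (measurable_pi_lambda _ fun v => hπ.comp (measurable_pi_apply v))
    (fun i : V → κ => ∏ e ∈ H.edgeFinset, M.onEdge i e)
  rw [homDensity]
  simp only [onEdge_comap]
  refine h.trans ?_
  rw [weightedHomDensity]
  refine Finset.sum_congr (by congr!) fun i _ => ?_
  have hpre : (fun (x : V → Ω) v => π (x v)) ⁻¹' {i} = Set.univ.pi fun v => π ⁻¹' {i v} := by
    ext x
    simp [funext_iff]
  rw [hpre, measureReal_def, Measure.pi_pi, ENNReal.toReal_prod, mul_comm]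
  rfl

theorem isRegular_comap (M : Graphon κ) (hπ : Measurable π) {p : ℝ}
    (h : ∀ i, ∑ j, μ.real (π ⁻¹' {i}) * μ.real (π ⁻¹' {j}) * M.toFun i j =
      p * μ.real (π ⁻¹' {i})) : (M.comap π hπ).IsRegular μ p := by
  have hnull : ∀ i, μ.real (π ⁻¹' {i}) = 0 → ∀ᵐ x ∂μ, π x ≠ i := by
    intro i hi
    rw [measureReal_eq_zero_iff] at hi
    simp only [ae_iff, ne_eq, not_not]
    exact hi
  have hae : ∀ᵐ x ∂μ, ∀ i, μ.real (π ⁻¹' {i}) = 0 → π x ≠ i :=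
    ae_all_iff.2 fun i => Filter.eventually_imp_distrib_left.2 (hnull i)
  filter_upwards [hae] with x hx
  have h1 : (M.comap π hπ).deg μ x = ∑ j, M.toFun (π x) j * μ.real (π ⁻¹' {j}) :=
    integral_comp_eq_sum hπ fun j => M.toFun (π x) j
  have h0 : μ.real (π ⁻¹' {π x}) ≠ 0 := fun h0 => hx _ h0 rfl
  have h2 := h (π x)
  simp only [mul_assoc] at h2
  rw [← Finset.mul_sum, mul_comm p] at h2
  rw [h1, ← mul_left_cancel₀ h0 h2]
  exact Finset.sum_congr rfl fun j _ => mul_comm _ _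

theorem isLocallyDense_comap (M : Graphon κ) (hπ : Measurable π) {p : ℝ}
    (h : ∀ f : κ → ℝ, (∀ i, f i ∈ Set.Icc 0 (μ.real (π ⁻¹' {i}))) →
      p * (∑ i, f i) ^ 2 ≤ ∑ i, ∑ j, f i * f j * M.toFun i j) :
    (M.comap π hπ).IsLocallyDense μ p := by
  intro U hU
  have hf : ∀ i, (μ.restrict U).real (π ⁻¹' {i}) ∈ Set.Icc 0 (μ.real (π ⁻¹' {i})) := fun i => by
    refine ⟨measureReal_nonneg, ?_⟩
    rw [measureReal_restrict_apply (hπ (measurableSet_singleton i))]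
    exact measureReal_mono Set.inter_subset_left
  have h1 := h _ hf
  have h2 : ∑ i, (μ.restrict U).real (π ⁻¹' {i}) = μ.real U := by
    simpa using (integral_comp_eq_sum (m := μ.restrict U) hπ fun _ => (1 : ℝ)).symm
  have h3 : ∫ x in U, ∫ y in U, (M.comap π hπ).toFun x y ∂μ ∂μ =
      ∑ i, ∑ j, (μ.restrict U).real (π ⁻¹' {i}) * (μ.restrict U).real (π ⁻¹' {j}) *
        M.toFun i j := by
    have hin : ∀ x, ∫ y in U, (M.comap π hπ).toFun x y ∂μ =
        ∑ j, M.toFun (π x) j * (μ.restrict U).real (π ⁻¹' {j}) := fun x =>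
      integral_comp_eq_sum hπ fun j => M.toFun (π x) j
    simp only [hin]
    rw [integral_comp_eq_sum (m := μ.restrict U) hπ fun i =>
      ∑ j, M.toFun i j * (μ.restrict U).real (π ⁻¹' {j})]
    refine Finset.sum_congr rfl fun i _ => ?_
    rw [Finset.sum_mul]
    exact Finset.sum_congr rfl fun j _ => by ring
  rw [h3, ← h2]
  exact h1

/-- The bound for graphons gives the same bound for finite weighted kernels: blow the vertices up to
the parts of an atomless space. -/
theorem le_weightedHomDensity {V : Type v} [Fintype V] {H : SimpleGraph V} [DecidableRel H.Adj]
    {c : ℝ} (hH : HasRegularLocallyDenseBound.{u, v} H c) {κ : Type} [Fintype κ]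
    [MeasurableSpace κ] [MeasurableSingletonClass κ] (M : Graphon κ) {w : κ → ℝ}
    (hw : ∀ i, 0 ≤ w i) (hsum : ∑ i, w i = 1) {p : ℝ}
    (hreg : ∀ i, ∑ j, w i * w j * M.toFun i j = p * w i)
    (hdense : ∀ f : κ → ℝ, (∀ i, f i ∈ Set.Icc 0 (w i)) →
      p * (∑ i, f i) ^ 2 ≤ ∑ i, ∑ j, f i * f j * M.toFun i j) :
    c * p ^ H.edgeFinset.card ≤ weightedHomDensity H w M := by
  obtain ⟨Ω, _, _, μ, _, _, π, hπ, hμ⟩ := exists_atomless_measure_preimage_eq.{u} hw hsum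
  have := hH Ω μ (M.comap π hπ) p (isLocallyDense_comap M hπ (by simpa only [hμ] using hdense))
    (isRegular_comap M hπ (by simpa only [hμ] using hreg))
  rw [homDensity_comap] at this
  simpa only [hμ] using this

theorem tendsto_weightedHomDensity {V κ : Type*} [Fintype V] [Fintype κ] [MeasurableSpace κ]
    (H : SimpleGraph V) [DecidableRel H.Adj] {w : ℕ → κ → ℝ} {M : ℕ → Graphon κ} {w₀ : κ → ℝ}
    {M₀ : Graphon κ}
    (hw : ∀ i, Filter.Tendsto (fun k => w k i) Filter.atTop (nhds (w₀ i)))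
    (hM : ∀ i j, Filter.Tendsto (fun k => (M k).toFun i j) Filter.atTop (nhds (M₀.toFun i j))) :
    Filter.Tendsto (fun k => weightedHomDensity H (w k) (M k)) Filter.atTop
      (nhds (weightedHomDensity H w₀ M₀)) := by
  refine tendsto_finsetSum _ fun i _ => (tendsto_finsetProd _ fun v _ => hw _).mul
    (tendsto_finsetProd _ fun e _ => ?_)
  induction e with | _ u v => exact hM _ _

end Graphon

namespace SimpleGraph

theorem isRegularKNRS_of_hasRegularLocallyDenseBound {V : Type v} [Fintype V] {H : SimpleGraph V}
    [DecidableRel H.Adj] (hH : HasRegularLocallyDenseBound.{u, v} H 1) : H.IsRegularKNRS := by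
  classical
  intro p hp ε hε
  by_contra! hcon
  set E : ℕ := H.edgeFinset.card with hE
  set η : ℝ := ε / (2 * (E + 1)) with hη
  have hη0 : 0 < η := div_pos hε.1 (by positivity)
  have hEη : E * η ≤ ε / 2 := by
    rw [hη, mul_div_assoc', div_le_div_iff₀ (by positivity) two_pos]
    nlinarith [hε.1]
  obtain ⟨K, hK⟩ := exists_isCutRegular hη0
  -- quotients of a sequence of counterexamples, with a bounded number of cells
  have hstep : ∀ k : ℕ, ∃ (w : Fin K → ℝ) (M : Graphon (Fin K)), (∀ i, 0 ≤ w i) ∧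
      ∑ i, w i = 1 ∧
      (∀ i, |∑ j, w i * w j * M.toFun i j - p * w i| ≤ 2 * (1 / ((k : ℝ) + 1))) ∧
      (∀ f : Fin K → ℝ, (∀ i, f i ∈ Set.Icc 0 (w i)) →
        p * (∑ i, f i) ^ 2 - p * (1 / ((k : ℝ) + 1)) ^ 2 ≤ ∑ i, ∑ j, f i * f j * M.toFun i j) ∧
      Graphon.weightedHomDensity H w M ≤ p ^ E - ε / 2 := by
    intro k
    have hδ : (0 : ℝ) < 1 / ((k : ℝ) + 1) := by positivity
    obtain ⟨V', _, _, G, hG1, hG2, hG3⟩ := hcon _ hδ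
    let _ : Fintype V' := Fintype.ofFinite V'
    let _ : MeasurableSpace V' := ⊤
    obtain ⟨c, hc⟩ := hK V' (Function.uncurry G.toGraphon.toFun)
      fun z => G.toGraphon.mem_Icc' z.1 z.2
    refine ⟨Graphon.cellWeight c, G.toGraphon.quotient c, Graphon.cellWeight_nonneg c,
      Graphon.sum_cellWeight c, fun i => hG2.abs_sum_quotient_sub_le ⟨hp.1.le, hp.2.le⟩ hδ.le c i,
      fun f hf => hG1.le_sum_quotient hp.1.le c hf, ?_⟩
    have := Graphon.weightedHomDensity_quotient_le H G.toGraphon (measurable_of_finite c) hc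
    rw [← homDensity_eq_sum_prod] at this
    linarith
  choose w M hw hsum hreg hdense hhom using hstep
  have hw1 : ∀ k i, w k i ≤ 1 := fun k i => by
    rw [← hsum k]
    exact Finset.single_le_sum (fun j _ => hw k j) (Finset.mem_univ i)
  -- compactness: pass to a limit of the weights and of the densities
  have hcpt : IsCompact ((Set.univ.pi fun _ : Fin K => Set.Icc (0 : ℝ) 1) ×ˢ
      (Set.univ.pi fun _ : Fin K => Set.univ.pi fun _ : Fin K => Set.Icc (0 : ℝ) 1)) :=
    (isCompact_univ_pi fun _ => isCompact_Icc).prod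
      (isCompact_univ_pi fun _ => isCompact_univ_pi fun _ => isCompact_Icc)
  obtain ⟨⟨w₀, N⟩, hmem, s, hs, hlim⟩ := hcpt.tendsto_subseq
    (x := fun k => (w k, (M k).toFun)) fun k =>
      ⟨fun i _ => ⟨hw k i, hw1 k i⟩, fun i _ j _ => (M k).mem_Icc' i j⟩
  have hlimw : ∀ i, Filter.Tendsto (fun k => w (s k) i) Filter.atTop (nhds (w₀ i)) := fun i =>
    tendsto_pi_nhds.1 hlim.fst_nhds i
  have hlimM : ∀ i j, Filter.Tendsto (fun k => (M (s k)).toFun i j) Filter.atTop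
      (nhds (N i j)) := fun i j =>
    tendsto_pi_nhds.1 (tendsto_pi_nhds.1 hlim.snd_nhds i) j
  let M₀ : Graphon (Fin K) :=
    { toFun := N
      measurable' := measurable_of_finite _
      symm' := fun i j => tendsto_nhds_unique (hlimM i j) (by
        simpa only [(M _).symm' i j] using hlimM j i)
      mem_Icc' := fun i j => hmem.2 i (Set.mem_univ i) j (Set.mem_univ j) }
  have hδ : Filter.Tendsto (fun k => 1 / ((s k : ℝ) + 1)) Filter.atTop (nhds 0) :=
    tendsto_one_div_add_atTop_nhds_zero_nat.comp hs.tendsto_atTop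
  have key := Graphon.le_weightedHomDensity hH M₀ (w := w₀) (p := p)
    (fun i => (hmem.1 i (Set.mem_univ i)).1)
    (tendsto_nhds_unique (tendsto_finsetSum _ fun i _ => hlimw i) (by
      simp only [hsum]; exact tendsto_const_nhds))
    (fun i => by
      have h1 : Filter.Tendsto (fun k => |∑ j, w (s k) i * w (s k) j * (M (s k)).toFun i j -
          p * w (s k) i|) Filter.atTop (nhds |∑ j, w₀ i * w₀ j * M₀.toFun i j - p * w₀ i|) :=
        ((tendsto_finsetSum _ fun j _ => ((hlimw i).mul (hlimw j)).mul (hlimM i j)).sub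
          ((hlimw i).const_mul p)).abs
      have h2 := le_of_tendsto_of_tendsto' h1 (hδ.const_mul 2) fun k => hreg (s k) i
      rw [mul_zero] at h2
      exact sub_eq_zero.1 (abs_nonpos_iff.1 h2))
    (fun f hf => by
      -- truncate `f` so that it is admissible along the sequence
      have hf' : ∀ i, Filter.Tendsto (fun k => min (f i) (w (s k) i)) Filter.atTop
          (nhds (f i)) := fun i => by
        have := (tendsto_const_nhds (x := f i)).min (hlimw i)
        rwa [min_eq_left (hf i).2] at this
      have h1 := le_of_tendsto_of_tendsto'
        ((((tendsto_finsetSum Finset.univ fun i _ => hf' i).pow 2).const_mul p).sub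
          ((hδ.pow 2).const_mul p))
        (tendsto_finsetSum Finset.univ fun i _ => tendsto_finsetSum Finset.univ fun j _ =>
          ((hf' i).mul (hf' j)).mul (hlimM i j))
        fun k => hdense (s k) _ fun i => ⟨le_min (hf i).1 (hw _ i), min_le_right _ _⟩
      simpa using h1)
  have h3 := le_of_tendsto (Graphon.tendsto_weightedHomDensity H (M₀ := M₀) hlimw hlimM)
    (.of_forall fun k => hhom (s k))
  linarith [hε.1]

end SimpleGraph

theorem proposition4p10 {V : Type v} [Fintype V] (H : SimpleGraph V) [DecidableRel H.Adj]
    (hH : ∃ c : ℝ, 0 < c ∧ HasRegularLocallyDenseBound.{u, v} H c) :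
    HasRegularLocallyDenseBound.{u, v} H 1 ∧ H.IsRegularKNRS := by
  obtain ⟨c, hc, hH⟩ := hH
  exact ⟨hH.one hc, SimpleGraph.isRegularKNRS_of_hasRegularLocallyDenseBound (hH.one hc)⟩
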